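/- Let $1\le p<n$ be integers. Consider the polynomial ring $R=\mathbb C[\{z_{i,j}^{(k)}\}]$ in variables $z_{i,j}^{(k)}$ with $1\le i\le p$, $1\le j\le n$, $k\in\mathbb N_0$, and let $Z(t)$ be the $p\times n$ matrix with entries $z_{i,j}(t)=\sum_{k\ge0}z_{i,j}^{(k)}t^k$. For a $p$-tuple $I=(\alpha_1,\dots,\alpha_p)$ of integers in $[1,n]$ let $D_I^{(k)}$ be the coefficient of $t^k$ in the determinant of the $p\times p$ matrix whose $m$-th column is the $\alpha_m$-th column of $Z(t)$. Let $\tilde{\mathcal P}\subset R$ be the subalgebra generated by all $D_I^{(k)}$ (the semi-infinite Plücker algebra). Order the variables $z_{i,j}^{(k)}$ first by $k$, then by $i$, then by $j$, and let $<_{\mathrm{ss}}$ be the corresponding degree reverse lexicographic order: $m_1<_{\mathrm{ss}}m_2$ if $\deg m_1<\deg m_2$, or if $\deg m_1=\deg m_2$ and the last variable whose exponents in $m_1$ and $m_2$ differ has the larger exponent in $m_1$. Let $\mathrm{in}_{<_{\mathrm{ss}}}f$ denote the $<_{\mathrm{ss}}$-maximal term of $f$, and let $\mathrm{in}_{<_{\mathrm{ss}}}\tilde{\mathcal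 P}\subset R$ be the subalgebra spanned by the initial terms of all elements of $\tilde{\mathcal P}$. It is $\mathbb N_0$-graded, the component of degree $d$ consisting of its elements that are homogeneous of total degree $pd$ (so that $\mathrm{in}_{<_{\mathrm{ss}}}D_I^{(k)}$, when nonzero, has degree $1$). Let $(\tilde Q,\preceq)$ be the poset of elements $q_{i,j}$ with $i\ge1$, $j\ge p+1$, $0\le j-i\le n-1$, where $q_{i_1,j_1}\preceq q_{i_2,j_2}$ if and only if at least one of the following holds: $i_1\le i_2$ and $j_1\le j_2$; or $i_1+p\le i_2$; or $j_1+n-p\le j_2$. For a finite order ideal $J\subset\tilde Q$ let $v_{\tilde Q,\varnothing}(J)\in\{0,1\}^{\tilde Q}$ be its indicator vector, and put $\mathbf y^{v_{\tilde Q,\varnothing}(J)}=\prod_{q\in J}y_q$. Let $A_{\tilde Q,\varnothing}(\tilde Q,\prec)\subset\mathbb C[\{y_q\}_{q\in\tilde Q}][s]$ be the subalgebra generated by the monomials $s\,\mathbf y^{v_{\tilde Q,\varnothing}(J)}$ over all finite order ideals $J$ (the Hibi ring of the order polytope of $\tilde Q$), $\mathbb N_0$-graded by degree in $s$. For an increasing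 $p$-tuple $I=(\alpha_1<\dots<\alpha_p)$ in $[1,n]$ and $k\in\mathbb N_0$ let $\varphi_{\mathrm{ss}}(I^{(k)})\subset\tilde Q$ consist of all $q_{i,j}$ with $i\le k$ and of all $q_{i,j}$ with $k+1\le i\le k+p$ and $j\le i+\alpha_{p+1-(i-k)}-1$. Then $\mathrm{in}_{<_{\mathrm{ss}}}\tilde{\mathcal P}$ is isomorphic to $A_{\tilde Q,\varnothing}(\tilde Q,\prec)$ as an $\mathbb N_0$-graded $\mathbb C$-algebra. The isomorphism is given (uniquely determined) by $$\mathrm{in}_{<_{\mathrm{ss}}}D_I^{(k)}\ \mapsto\ (-1)^{\binom n2+r(n-1)}\,s\,\mathbf y^{v_{\tilde Q,\varnothing}(\varphi_{\mathrm{ss}}(I^{(k)}))}$$ for all increasing $p$-tuples $I$ in $[1,n]$ and all $k\in\mathbb N_0$, where $k\equiv r\pmod p$ with $r\in[0,p-1]$. -/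

import Mathlib

noncomputable section

namespace SemiInfinite

/-! ### Monomial orders, initial terms and initial subalgebras -/

section Initial

variable {σ : Type*}

/-- The strict degree reverse lexicographic order on monomials (given by their exponents) for
linearly ordered variables: compare total degrees first; for equal total degrees, `a < b` if and
only if the last nonzero entry of `a - b` is positive. -/
def DegRevLexLT [LinearOrder σ] (a b : σ →₀ ℕ) : Prop :=
  a.degree < b.degree ∨
    (a.degree = b.degree ∧ ∃ i, b i < a i ∧ ∀ j, i < j → a j = b j)

open Classical in
/-- The initial term of `f` with respect to a strict order `lt` on monomials: the `lt`-maximal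
term that occurs in `f` (with its coefficient), and `0` if `f = 0`. -/
def initialTerm (lt : (σ →₀ ℕ) → (σ →₀ ℕ) → Prop) (f : MvPolynomial σ ℂ) : MvPolynomial σ ℂ :=
  ∑ m ∈ f.support.filter (fun m => ∀ m' ∈ f.support, m' ≠ m → lt m' m),
    MvPolynomial.monomial m (f.coeff m)

/-- The initial subalgebra of `A`: the subalgebra generated by the initial terms of all elements
of `A`. -/
def initialSubalgebra (lt : (σ →₀ ℕ) → (σ →₀ ℕ) → Prop) (A : Subalgebra ℂ (MvPolynomial σ ℂ)) :
    Subalgebra ℂ (MvPolynomial σ ℂ) :=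
  Algebra.adjoin ℂ {g | ∃ f ∈ A, g = initialTerm lt f}

theorem initialTerm_mem (lt : (σ →₀ ℕ) → (σ →₀ ℕ) → Prop)
    {A : Subalgebra ℂ (MvPolynomial σ ℂ)} {f : MvPolynomial σ ℂ} (hf : f ∈ A) :
    initialTerm lt f ∈ initialSubalgebra lt A :=
  Algebra.subset_adjoin ⟨f, hf, rfl⟩

end Initial

/-! ### Generalized Hibi rings -/

section Hibi

variable {P : Type*} [LE P]

open Classical in
/-- The point `v_{O,C}(J)` of a finite order ideal `J`: its coordinate at `q` is `1` if
`q ∈ J ∩ O` or `q ∈ max J ∩ C`, and `0` otherwise. -/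
def idealPoint (O C : Set P) (J : Finset P) : P →₀ ℕ :=
  Finsupp.onFinset J
    (fun q => if (q ∈ J ∧ q ∈ O) ∨ (Maximal (· ∈ J) q ∧ q ∈ C) then 1 else 0) (by
      intro q hq
      by_contra hJ
      apply hq
      rw [if_neg]
      rintro (⟨h, -⟩ | ⟨h, -⟩)
      · exact hJ h
      · exact hJ h.1)

/-- The monomial `s * y ^ u` of `ℂ[P][s]`. -/
def sMonomial (u : P →₀ ℕ) : Polynomial (MvPolynomial P ℂ) :=
  Polynomial.X * Polynomial.C (MvPolynomial.monomial u 1)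

variable (P) in
/-- The generalized Hibi ring `A_{O,C}(P) ⊆ ℂ[P][s]`, generated by the monomials
`s * y ^ v_{O,C}(J)`, where `J` runs over the finite order ideals of `P`. -/
def hibiRing (O C : Set P) : Subalgebra ℂ (Polynomial (MvPolynomial P ℂ)) :=
  Algebra.adjoin ℂ {g | ∃ J : Finset P, IsLowerSet (J : Set P) ∧ g = sMonomial (idealPoint O C J)}

variable (P) in
/-- The component of degree `d` of the generalized Hibi ring, for the grading by degree in `s`:
the elements of the form `c * s ^ d` with `c ∈ ℂ[P]`. -/
def hibiGrade (O C : Set P) (d : ℕ) : Submodule ℂ (hibiRing P O C) :=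
  (LinearMap.range ((Polynomial.monomial (R := MvPolynomial P ℂ) d).restrictScalars ℂ)).comap
    (hibiRing P O C).val.toLinearMap

end Hibi

/-! ### The semi-infinite Plücker algebra -/

section Pluecker

variable (n p : ℕ)

/-- Indices of the variables `z_{i,j}^{(k)}`, ordered first by `k`, then by `i`, then by `j`. -/
abbrev ZVar : Type := ℕ ×ₗ (Fin p ×ₗ Fin n)

variable {n p} in
/-- The variable `z_{i,j}^{(k)}`. -/
def zvar (k : ℕ) (i : Fin p) (j : Fin n) : MvPolynomial (ZVar n p) ℂ :=
  MvPolynomial.X (toLex (k, toLex (i, j)))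

/-- The `p × n` matrix `Z(t)` with entries `z_{i,j}(t) = ∑ k, z_{i,j}^{(k)} t ^ k`. -/
def zMatrix : Matrix (Fin p) (Fin n) (PowerSeries (MvPolynomial (ZVar n p) ℂ)) :=
  Matrix.of fun i j => PowerSeries.mk fun k => zvar k i j

variable {n p} in
/-- `D_I^{(k)}`: the coefficient of `t ^ k` in the determinant of the matrix formed by the columns
`I 0, …, I (p - 1)` of `Z(t)`. -/
def plueckerD (I : Fin p → Fin n) (k : ℕ) : MvPolynomial (ZVar n p) ℂ :=
  PowerSeries.coeff k ((zMatrix n p).submatrix id I).det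

/-- The semi-infinite Plücker algebra, generated by all `D_I^{(k)}`. -/
def plueckerAlgebra : Subalgebra ℂ (MvPolynomial (ZVar n p) ℂ) :=
  Algebra.adjoin ℂ {g | ∃ (I : Fin p → Fin n) (k : ℕ), g = plueckerD I k}

/-- The initial subalgebra of the semi-infinite Plücker algebra. -/
def initialPluecker : Subalgebra ℂ (MvPolynomial (ZVar n p) ℂ) :=
  initialSubalgebra DegRevLexLT (plueckerAlgebra n p)

/-- The component of degree `d` of the initial subalgebra. The generators `D_I^{(k)}`, which are
homogeneous of total degree `p`, have degree `1`; so degree `d` means total degree `p * d`. -/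
def initialGrade (d : ℕ) : Submodule ℂ (initialPluecker n p) :=
  (MvPolynomial.homogeneousSubmodule (ZVar n p) ℂ (p * d)).comap
    (initialPluecker n p).val.toLinearMap

variable {n p} in
/-- The initial term of `D_I^{(k)}`, as an element of the initial subalgebra. -/
def initialD (I : Fin p → Fin n) (k : ℕ) : initialPluecker n p :=
  ⟨initialTerm DegRevLexLT (plueckerD I k),
    initialTerm_mem _ (Algebra.subset_adjoin ⟨I, k, rfl⟩)⟩

end Pluecker

/-! ### The poset `Q̃` -/

section Poset

variable (n p : ℕ)

/-- The set of the `q_{i,j}` with `i ≥ 1`, `j ≥ p + 1` and `0 ≤ j - i ≤ n - 1`. -/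
@[ext]
structure TildeQ where
  i : ℕ
  j : ℕ
  one_le : 1 ≤ i
  lt_j : p + 1 ≤ j
  le : i ≤ j
  lt : j < i + n

/-- `q_{i₁,j₁} ⪯ q_{i₂,j₂}` if `i₁ ≤ i₂` and `j₁ ≤ j₂`, or `i₁ + p ≤ i₂`, or
`j₁ + (n - p) ≤ j₂`. -/
instance : LE (TildeQ n p) where
  le a b := (a.i ≤ b.i ∧ a.j ≤ b.j) ∨ a.i + p ≤ b.i ∨ a.j + (n - p) ≤ b.j

theorem TildeQ.le_def {n p : ℕ} (a b : TildeQ n p) :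
    a ≤ b ↔ (a.i ≤ b.i ∧ a.j ≤ b.j) ∨ a.i + p ≤ b.i ∨ a.j + (n - p) ≤ b.j := Iff.rfl

/-- For `1 ≤ p < n` the relation is a partial order. -/
theorem TildeQ.isPartialOrder (hp : 1 ≤ p) (hpn : p < n) :
    IsPartialOrder (TildeQ n p) (· ≤ ·) where
  refl a := Or.inl ⟨le_rfl, le_rfl⟩
  trans a b c := by
    obtain ⟨i₁, j₁, h₁, h₂, h₃, h₄⟩ := a
    obtain ⟨i₂, j₂, h₅, h₆, h₇, h₈⟩ := b
    obtain ⟨i₃, j₃, h₉, h₁₀, h₁₁, h₁₂⟩ := c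
    simp only [TildeQ.le_def]
    omega
  antisymm a b := by
    obtain ⟨i₁, j₁, h₁, h₂, h₃, h₄⟩ := a
    obtain ⟨i₂, j₂, h₅, h₆, h₇, h₈⟩ := b
    simp only [TildeQ.le_def, TildeQ.mk.injEq]
    omega

variable {n p}

/-- The set `φ_ss(I^{(k)})`. It contains `q_{i,j}` if `i ≤ k`, or if `k + 1 ≤ i ≤ k + p` and
`j ≤ i + α_{p + 1 - (i - k)} - 1`, where `I = (α_1, …, α_p)`. Entries and values of `I` are
counted from `0` here, so `α_{m + 1} = I m + 1`, and `m + 1 = p + 1 - (i - k)` says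
`i + m = k + p`. -/
def phiSet (I : Fin p → Fin n) (k : ℕ) : Set (TildeQ n p) :=
  {q | q.i ≤ k ∨ ∃ m : Fin p, q.i + m = k + p ∧ q.j ≤ q.i + I m}

theorem phiSet_finite (I : Fin p → Fin n) (k : ℕ) : (phiSet I k).Finite := by
  apply Set.Finite.of_finite_image (f := fun q : TildeQ n p => (q.i, q.j))
  · apply (Set.finite_Iic ((k + p, k + p + n) : ℕ × ℕ)).subset
    rintro _ ⟨q, hq, rfl⟩
    have h := q.lt
    have hi : q.i ≤ k + p := by
      rcases hq with hq | ⟨m, hm, -⟩ <;> omega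
    exact ⟨hi, by change q.j ≤ k + p + n; omega⟩
  · intro a _ b _ hab
    exact TildeQ.ext (congrArg Prod.fst hab) (congrArg Prod.snd hab)

/-- `φ_ss(I^{(k)})` as a finite subset of `Q̃`. -/
def phi (I : Fin p → Fin n) (k : ℕ) : Finset (TildeQ n p) := (phiSet_finite I k).toFinset

end Poset

end SemiInfinite

end

/-!
The products of Plücker coordinates `D_I^{(k)}` over chains of the order ideals `φ_ss(I^{(k)})`
span the Plücker algebra. Indeed, if the ideals of `I^{(a)}` and `J^{(b)}` with `a ≤ b` are
incomparable, the product of the coordinates is straightened by a Garnir relation: antisymmetrizing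
the product of a minor of `Z(t)` and one of `Z(λ t)` over `p + b - a + 1` columns gives a multiple
of `(λ - 1) ^ (b - a + 1)`, since for `λ = 1` both matrices have the same `p` rows.
The initial monomial of `D_I^{(k)}` picks the entries of `I`, in decreasing order, from the `p`
consecutive rows `k, …, k + p - 1` of the stacked coefficient matrices of `Z(t)`, and sending the
variable in row `r` and column `c` to a suitable monomial in `s` and the `y_q` maps this initial
monomial to `s y ^ φ_ss(I^{(k)})`. Since a chain of order ideals is determined by its sum, the
images of the initial monomials of distinct standard products are distinct monomials. This shows
at once that the standard products have distinct initial monomials, so that these span the initial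
subalgebra, and that the monomial map is injective on it; it is onto the Hibi ring because every
finite order ideal of `Q̃` is of the form `φ_ss(I^{(k)})`.
-/

noncomputable section

namespace SemiInfinite

section FinsetSums

theorem sum_lt_sum_of_card_eq_of_ne {ι M : Type*} [DecidableEq ι] [AddCommMonoid M] [LinearOrder M]
    [IsOrderedCancelAddMonoid M] {s t : Finset ι} {f : ι → M} (hcard : s.card = t.card)
    (hne : s ≠ t) (hlt : ∀ i ∈ s \ t, ∀ j ∈ t, f i < f j) :
    ∑ i ∈ s, f i < ∑ j ∈ t, f j := by
  have hcard' : (s \ t).card = (t \ s).card := Finset.card_sdiff_comm hcard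
  have hst : (s \ t).Nonempty :=
    Finset.sdiff_nonempty.2 fun h => hne (Finset.eq_of_subset_of_card_le h hcard.ge)
  have hts : (t \ s).Nonempty := by
    rw [← Finset.card_pos, ← hcard', Finset.card_pos]
    exact hst
  obtain ⟨j, hj, hmin⟩ := Finset.exists_min_image (t \ s) f hts
  rw [← Finset.sum_inter_add_sum_sdiff s t, ← Finset.sum_inter_add_sum_sdiff t s,
    Finset.inter_comm t s]
  gcongr ?_ + ?_
  calc ∑ i ∈ s \ t, f i < ∑ _i ∈ s \ t, f j :=
        Finset.sum_lt_sum_of_nonempty hst fun i hi => hlt i hi j (Finset.mem_sdiff.1 hj).1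
    _ = ∑ _i ∈ t \ s, f j := by rw [Finset.sum_const, Finset.sum_const, hcard']
    _ ≤ ∑ i ∈ t \ s, f i := Finset.sum_le_sum hmin

end FinsetSums

section DegRevLex

variable {σ : Type*} [LinearOrder σ]

/-- The degree reverse lexicographic order as an embedding of the monoid of monomials into a
linearly ordered one: `DegRevLexLT` is the order pulled back along this map. -/
def degRevLexKey : (σ →₀ ℕ) →+ ℕ ×ₗ (Colex (σ →₀ ℕ))ᵒᵈ where
  toFun a := toLex (a.degree, OrderDual.toDual (toColex a))
  map_zero' := by
    rw [map_zero]
    rfl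
  map_add' a b := by
    rw [map_add]
    rfl

omit [LinearOrder σ] in
theorem degRevLexKey_injective : Function.Injective (degRevLexKey (σ := σ)) :=
  fun _ _ h => congrArg Prod.snd h

theorem degRevLexLT_iff {a b : σ →₀ ℕ} : DegRevLexLT a b ↔ degRevLexKey a < degRevLexKey b := by
  rw [degRevLexKey, AddMonoidHom.coe_mk, ZeroHom.coe_mk, Prod.Lex.toLex_lt_toLex,
    OrderDual.toDual_lt_toDual, Finsupp.Colex.lt_iff]
  refine or_congr_right (and_congr_right fun _ => exists_congr fun i => ?_)
  rw [and_comm]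
  exact and_congr_left fun _ => forall₂_congr fun _ _ => eq_comm

end DegRevLex

section LeadingMonomial

variable {σ R B : Type*} [CommSemiring R] [AddCommMonoid B] [LinearOrder B]
  {D : (σ →₀ ℕ) →+ B}

/-- The monomial `m` is the leading monomial of `f` when monomials are compared by their images
under `D`. -/
def IsLeading (D : (σ →₀ ℕ) →+ B) (f : MvPolynomial σ R) (m : σ →₀ ℕ) : Prop :=
  m ∈ f.support ∧ ∀ m' ∈ f.support, m' ≠ m → D m' < D m

theorem IsLeading.initialTerm_eq {lt : (σ →₀ ℕ) → (σ →₀ ℕ) → Prop}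
    (hlt : ∀ {a b}, lt a b ↔ D a < D b) {f : MvPolynomial σ ℂ} {m : σ →₀ ℕ}
    (h : IsLeading D f m) : initialTerm lt f = MvPolynomial.monomial m (f.coeff m) := by
  classical
  refine Finset.sum_eq_single_of_mem m ?_ fun m' hm' hne => ?_
  · exact Finset.mem_filter.2 ⟨h.1, fun m' hm' hne => hlt.2 (h.2 m' hm' hne)⟩
  · have hlt' := (Finset.mem_filter.1 hm').2 m h.1 hne.symm
    exact absurd (hlt.1 hlt') (h.2 m' (Finset.mem_filter.1 hm').1 hne).not_gt

theorem IsLeading.one [Nontrivial R] : IsLeading D (1 : MvPolynomial σ R) 0 := by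
  classical
  refine ⟨by simp, fun m hm hne => absurd ?_ (MvPolynomial.mem_support_iff.1 hm)⟩
  rw [MvPolynomial.coeff_one, if_neg hne.symm]

theorem IsLeading.mul [NoZeroDivisors R] [IsOrderedCancelAddMonoid B] {f g : MvPolynomial σ R}
    {m m' : σ →₀ ℕ} (hf : IsLeading D f m) (hg : IsLeading D g m') :
    IsLeading D (f * g) (m + m') := by
  classical
  have hle {h : MvPolynomial σ R} {l x : σ →₀ ℕ} (hl : IsLeading D h l) (hx : x ∈ h.support) :
      D x ≤ D l := by
    rcases eq_or_ne x l with rfl | hne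
    exacts [le_rfl, (hl.2 x hx hne).le]
  have hlt : ∀ x ∈ f.support, ∀ y ∈ g.support, (x, y) ≠ (m, m') → D (x + y) < D (m + m') := by
    intro x hx y hy hne
    rw [map_add, map_add]
    by_cases hxm : x = m
    · subst hxm
      exact add_lt_add_right (hg.2 y hy fun h => hne (by rw [h])) _
    · exact add_lt_add_of_lt_of_le (hf.2 x hx hxm) (hle hg hy)
  constructor
  · rw [MvPolynomial.mem_support_iff, MvPolynomial.coeff_mul,
      Finset.sum_eq_single_of_mem (m, m') (Finset.HasAntidiagonal.mem_antidiagonal.2 rfl)]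
    · exact mul_ne_zero (MvPolynomial.mem_support_iff.1 hf.1) (MvPolynomial.mem_support_iff.1 hg.1)
    · rintro ⟨x, y⟩ hxy hne
      by_contra h0
      refine (hlt x (MvPolynomial.mem_support_iff.2 (left_ne_zero_of_mul h0)) y
        (MvPolynomial.mem_support_iff.2 (right_ne_zero_of_mul h0)) hne).ne ?_
      rw [Finset.HasAntidiagonal.mem_antidiagonal.1 hxy]
  · intro e he hne
    obtain ⟨x, hx, y, hy, rfl⟩ := Finset.mem_add.1 (MvPolynomial.support_mul f g he)
    refine hlt x hx y hy fun h => hne ?_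
    rw [(Prod.mk.inj h).1, (Prod.mk.inj h).2]

theorem IsLeading.multiset_prod [Nontrivial R] [NoZeroDivisors R] [IsOrderedCancelAddMonoid B]
    {ι : Type*} {f : ι → MvPolynomial σ R} {m : ι → σ →₀ ℕ} (h : ∀ i, IsLeading D (f i) (m i))
    (s : Multiset ι) : IsLeading D (s.map f).prod (s.map m).sum := by
  induction s using Multiset.induction_on with
  | empty => simpa using IsLeading.one
  | cons a s ih => simpa using (h a).mul ih

theorem IsLeading.sum {ι : Type*} {s : Finset ι} {f : ι → MvPolynomial σ R} {m : ι → σ →₀ ℕ}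
    (h : ∀ i ∈ s, IsLeading D (f i) (m i)) {a : ι} (ha : a ∈ s)
    (hmax : ∀ b ∈ s, b ≠ a → D (m b) < D (m a)) : IsLeading D (∑ i ∈ s, f i) (m a) := by
  have hlt : ∀ b ∈ s, b ≠ a → ∀ e ∈ (f b).support, D e < D (m a) := by
    intro b hb hba e he
    by_cases heb : e = m b
    · exact heb ▸ hmax b hb hba
    · exact ((h b hb).2 e he heb).trans (hmax b hb hba)
  constructor
  · rw [MvPolynomial.mem_support_iff, MvPolynomial.coeff_sum, Finset.sum_eq_single_of_mem a ha]
    · exact MvPolynomial.mem_support_iff.1 (h a ha).1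
    · intro b hb hba
      by_contra h0
      exact (hlt b hb hba _ (MvPolynomial.mem_support_iff.2 h0)).ne rfl
  · intro e he hne
    rw [MvPolynomial.mem_support_iff, MvPolynomial.coeff_sum] at he
    obtain ⟨b, hb, hbe⟩ := Finset.exists_ne_zero_of_sum_ne_zero he
    have hbe := MvPolynomial.mem_support_iff.2 hbe
    by_cases hba : b = a
    · subst hba
      exact (h b hb).2 e hbe hne
    · exact hlt b hb hba e hbe

theorem IsLeading.smul [NoZeroDivisors R] {f : MvPolynomial σ R} {m : σ →₀ ℕ}
    (h : IsLeading D f m) {c : R} (hc : c ≠ 0) : IsLeading D (c • f) m := by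
  have hsupp : (c • f).support = f.support := by
    ext e
    simp only [MvPolynomial.mem_support_iff, MvPolynomial.coeff_smul, smul_eq_mul, ne_eq,
      mul_eq_zero, hc, false_or]
  rwa [IsLeading, hsupp]

theorem exists_isLeading_of_mem_span [NoZeroDivisors R] {ι : Type*} {f : ι → MvPolynomial σ R}
    {m : ι → σ →₀ ℕ} (h : ∀ i, IsLeading D (f i) (m i)) (hm : Function.Injective (D ∘ m))
    {g : MvPolynomial σ R} (hg : g ∈ Submodule.span R (Set.range f)) (hg0 : g ≠ 0) :
    ∃ i, IsLeading D g (m i) := by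
  obtain ⟨c, rfl⟩ := (Finsupp.mem_span_range_iff_exists_finsupp).1 hg
  have hc : c.support.Nonempty := by
    rw [Finsupp.support_nonempty_iff]
    rintro rfl
    exact hg0 Finsupp.sum_zero_index
  obtain ⟨a, ha, hmax⟩ := Finset.exists_max_image c.support (D ∘ m) hc
  exact ⟨a, IsLeading.sum (fun i hi => (h i).smul (Finsupp.mem_support_iff.1 hi)) ha
    fun b hb hba => (hmax b hb).lt_of_ne (hm.ne hba)⟩

theorem IsLeading.unique {f : MvPolynomial σ R} {m m' : σ →₀ ℕ} (h : IsLeading D f m)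
    (h' : IsLeading D f m') : m = m' := by
  by_contra hne
  exact (h.2 m' h'.1 (Ne.symm hne)).asymm (h'.2 m h.1 hne)

end LeadingMonomial

section InitialSubalgebra

variable {σ B ι : Type*} [AddCommMonoid B] [LinearOrder B]
  {D : (σ →₀ ℕ) →+ B} {lt : (σ →₀ ℕ) → (σ →₀ ℕ) → Prop} {A : Subalgebra ℂ (MvPolynomial σ ℂ)}
  {f : ι → MvPolynomial σ ℂ} {m : ι → σ →₀ ℕ}

theorem monomial_mem_initialSubalgebra (hlt : ∀ {a b}, lt a b ↔ D a < D b)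
    {g : MvPolynomial σ ℂ} (hg : g ∈ A) {e : σ →₀ ℕ} (h : IsLeading D g e) :
    MvPolynomial.monomial e 1 ∈ initialSubalgebra lt A := by
  have hmem := (initialSubalgebra lt A).smul_mem (initialTerm_mem lt hg) (g.coeff e)⁻¹
  rwa [h.initialTerm_eq hlt, MvPolynomial.smul_monomial, smul_eq_mul,
    inv_mul_cancel₀ (MvPolynomial.mem_support_iff.1 h.1)] at hmem

theorem toSubmodule_initialSubalgebra_eq_span [IsOrderedCancelAddMonoid B]
    (hlt : ∀ {a b}, lt a b ↔ D a < D b)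
    (hA : Subalgebra.toSubmodule A = Submodule.span ℂ (Set.range f))
    (h : ∀ i, IsLeading D (f i) (m i)) (hm : Function.Injective (D ∘ m)) :
    Subalgebra.toSubmodule (initialSubalgebra lt A) =
      Submodule.span ℂ (Set.range fun i => MvPolynomial.monomial (m i) 1) := by
  have hfA : ∀ i, f i ∈ A := fun i => by
    rw [← Subalgebra.mem_toSubmodule, hA]
    exact Submodule.subset_span ⟨i, rfl⟩
  have hlead : ∀ g ∈ A, g ≠ 0 → ∃ i, IsLeading D g (m i) := fun g hg hg0 =>
    exists_isLeading_of_mem_span h hm (hA ▸ (Subalgebra.mem_toSubmodule A).2 hg) hg0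
  have hrange : ∀ g ∈ A, ∀ e, IsLeading D g e → ∃ i, m i = e := fun g hg e he =>
    (hlead g hg fun h0 => by simpa [h0] using he.1).imp fun _ hi => hi.unique he
  let M : Submonoid (MvPolynomial σ ℂ) :=
    { carrier := Set.range fun i => MvPolynomial.monomial (m i) 1
      one_mem' := (hrange 1 A.one_mem 0 IsLeading.one).imp fun _ hi => by
        simp only [hi, MvPolynomial.monomial_zero', MvPolynomial.C_1]
      mul_mem' := by
        rintro _ _ ⟨i, rfl⟩ ⟨j, rfl⟩
        obtain ⟨k, hk⟩ := hrange _ (A.mul_mem (hfA i) (hfA j)) _ ((h i).mul (h j))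
        exact ⟨k, by simp only [hk, MvPolynomial.monomial_mul, one_mul]⟩ }
  have hM : Subalgebra.toSubmodule (Algebra.adjoin ℂ (M : Set (MvPolynomial σ ℂ))) =
      Submodule.span ℂ (Set.range fun i => MvPolynomial.monomial (m i) 1) := by
    rw [Algebra.adjoin_eq_span, Submonoid.closure_eq]
    rfl
  refine le_antisymm (le_of_le_of_eq (Algebra.adjoin_le ?_) hM) (Submodule.span_le.2 ?_)
  · rintro _ ⟨g, hg, rfl⟩
    rcases eq_or_ne g 0 with rfl | hg0
    · simp [initialTerm]
    · obtain ⟨i, hi⟩ := hlead g hg hg0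
      rw [hi.initialTerm_eq hlt, ← mul_one (g.coeff _), ← smul_eq_mul, ← MvPolynomial.smul_monomial]
      exact Subalgebra.smul_mem _ (Algebra.subset_adjoin (Set.mem_range_self i)) _
  · rintro _ ⟨i, rfl⟩
    exact monomial_mem_initialSubalgebra hlt (hfA i) (h i)

end InitialSubalgebra

section Rows

theorem sum_lt_sum_add_rev {p k : ℕ} {P : Fin p → ℕ} (hP : Function.Injective P)
    (hlt : ∀ m, P m < k + p) {s : Fin p} (hs : ∀ m, P m ≠ k + s.rev) :
    ∑ m, P m < ∑ m : Fin p, (k + (m.rev : ℕ)) := by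
  have hrev : Function.Injective fun m : Fin p => k + (m.rev : ℕ) :=
    fun a b h => Fin.rev_injective (Fin.ext (Nat.add_left_cancel h))
  have hmem : ∀ i, k ≤ i → i < k + p → i ∈ Finset.univ.image fun m : Fin p => k + (m.rev : ℕ) :=
    fun i hki hi => Finset.mem_image.2
      ⟨Fin.rev ⟨i - k, by omega⟩, Finset.mem_univ _, by rw [Fin.rev_rev, Nat.add_sub_cancel' hki]⟩
  have key := sum_lt_sum_of_card_eq_of_ne (s := Finset.univ.image P)
    (t := Finset.univ.image fun m : Fin p => k + (m.rev : ℕ)) (f := id)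
    (by rw [Finset.card_image_of_injective _ hP, Finset.card_image_of_injective _ hrev])
    (fun h => by
      have hs' : k + (s.rev : ℕ) ∈ Finset.univ.image P :=
        h ▸ Finset.mem_image_of_mem (fun m : Fin p => k + (m.rev : ℕ)) (Finset.mem_univ s)
      obtain ⟨m, -, hm⟩ := Finset.mem_image.1 hs'
      exact hs m hm)
    (fun i hi j hj => by
      rw [Finset.mem_sdiff] at hi
      obtain ⟨m, -, rfl⟩ := Finset.mem_image.1 hi.1
      obtain ⟨m', -, rfl⟩ := Finset.mem_image.1 hj
      have hk : P m < k := lt_of_not_ge fun hk => hi.2 (hmem _ hk (hlt m))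
      exact hk.trans_le (Nat.le_add_right _ _))
  rwa [Finset.sum_image hP.injOn, Finset.sum_image hrev.injOn] at key

variable {n p : ℕ} [NeZero p]

/-- The variable in row `r` and column `c` of the matrix obtained by stacking the coefficient
matrices of `Z(t)`: row `p * k + i` consists of the `z_{i,j}^{(k)}`. -/
def rowVar (r : ℕ) (c : Fin n) : ZVar n p := toLex (r / p, toLex (Fin.ofNat p r, c))

theorem rowVar_mul_add (l : ℕ) (i : Fin p) (c : Fin n) :
    (rowVar (p * l + i) c : ZVar n p) = toLex (l, toLex (i, c)) := by
  have hdiv : (p * l + i) / p = l := by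
    rw [Nat.mul_add_div (NeZero.pos p), Nat.div_eq_of_lt i.2, add_zero]
  have hmod : Fin.ofNat p (p * l + i) = i := by
    ext
    rw [Fin.val_ofNat, Nat.mul_add_mod, Nat.mod_eq_of_lt i.2]
  rw [rowVar, hdiv, hmod]

theorem exists_rowVar (v : ZVar n p) : ∃ r c, v = rowVar r c :=
  ⟨_, _, (rowVar_mul_add (ofLex v).1 (ofLex (ofLex v).2).1 (ofLex (ofLex v).2).2).symm⟩

theorem strictMono_rowVar :
    StrictMono fun x : ℕ ×ₗ Fin n => (rowVar (ofLex x).1 (ofLex x).2 : ZVar n p) := by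
  intro x y h
  simp only [rowVar, Prod.Lex.toLex_lt_toLex]
  rcases Prod.Lex.lt_iff.1 h with hr | ⟨hr, hc⟩
  · refine (Nat.div_le_div_right hr.le).lt_or_eq.imp_right fun hdiv => ⟨hdiv, Or.inl ?_⟩
    rw [Fin.lt_def, Fin.val_ofNat, Fin.val_ofNat]
    rw [← Nat.div_add_mod (ofLex x).1 p, ← Nat.div_add_mod (ofLex y).1 p, hdiv] at hr
    exact lt_of_add_lt_add_left hr
  · exact Or.inr ⟨by rw [hr], Or.inr ⟨by rw [hr], hc⟩⟩

theorem rowVar_lt_rowVar {r r' : ℕ} {c c' : Fin n} :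
    (rowVar r c : ZVar n p) < rowVar r' c' ↔ r < r' ∨ r = r' ∧ c < c' :=
  (strictMono_rowVar.lt_iff_lt (a := toLex (r, c)) (b := toLex (r', c'))).trans
    Prod.Lex.toLex_lt_toLex

theorem rowVar_inj {r r' : ℕ} {c c' : Fin n} :
    (rowVar r c : ZVar n p) = rowVar r' c' ↔ r = r' ∧ c = c' :=
  (strictMono_rowVar.injective.eq_iff (a := toLex (r, c)) (b := toLex (r', c'))).trans
    (toLex_inj.trans Prod.mk_inj)

/-- The exponent of the product of the variables in rows `P m` and columns `I m`. -/
def rowExp (P : Fin p → ℕ) (I : Fin p → Fin n) : ZVar n p →₀ ℕ :=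
  ∑ m, Finsupp.single (rowVar (P m) (I m)) 1

theorem degree_rowExp (P : Fin p → ℕ) (I : Fin p → Fin n) : (rowExp P I).degree = p := by
  simp [rowExp, map_sum]

theorem rowExp_apply {P : Fin p → ℕ} {I : Fin p → Fin n} (r : ℕ) (c : Fin n) :
    rowExp P I (rowVar r c) = ∑ m, if P m = r ∧ I m = c then 1 else 0 := by
  rw [rowExp, Finsupp.finsetSum_apply]
  exact Finset.sum_congr rfl fun m _ => by simp only [Finsupp.single_apply, rowVar_inj]

theorem rowExp_apply_of_injective {P : Fin p → ℕ} {I : Fin p → Fin n}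
    (hI : Function.Injective I) (r : ℕ) (m : Fin p) :
    rowExp P I (rowVar r (I m)) = if P m = r then 1 else 0 := by
  rw [rowExp_apply, Finset.sum_eq_single m]
  · simp only [and_true]
  · exact fun m' _ hne => if_neg fun h => hne (hI h.2)
  · exact fun h => absurd (Finset.mem_univ m) h

theorem rowExp_injective {I : Fin p → Fin n} (hI : Function.Injective I) :
    Function.Injective fun P : Fin p → ℕ => rowExp P I := by
  intro P P' h
  funext m
  have hm := DFunLike.congr_fun h (rowVar (P m) (I m))
  simp only [rowExp_apply_of_injective hI, if_true] at hm
  by_contra hne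
  rw [if_neg (Ne.symm hne)] at hm
  exact one_ne_zero hm

theorem exists_of_degRevLexLT_rowExp {P P' : Fin p → ℕ} {I : Fin p → Fin n}
    (hI : Function.Injective I) (h : DegRevLexLT (rowExp P I) (rowExp P' I)) :
    ∃ s, P' s ≠ P s ∧ ∀ m r, P s < r ∨ P s = r ∧ I s < I m → (P m = r ↔ P' m = r) := by
  rcases h with h | ⟨-, v, hv, hgt⟩
  · rw [degree_rowExp, degree_rowExp] at h
    exact absurd h (lt_irrefl _)
  obtain ⟨r, c, rfl⟩ := exists_rowVar v
  obtain ⟨s, rfl, rfl⟩ : ∃ s, P s = r ∧ I s = c := by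
    by_contra! hne
    rw [rowExp_apply (P := P), Finset.sum_eq_zero fun m _ => if_neg fun hm => hne m hm.1 hm.2] at hv
    exact Nat.not_lt_zero _ hv
  refine ⟨s, fun hs => ?_, fun m r hr => ?_⟩
  · rw [rowExp_apply_of_injective hI, rowExp_apply_of_injective hI, if_pos hs, if_pos rfl] at hv
    exact lt_irrefl _ hv
  · have hm := hgt (rowVar r (I m)) (rowVar_lt_rowVar.2 hr)
    rw [rowExp_apply_of_injective hI, rowExp_apply_of_injective hI] at hm
    split_ifs at hm with h h' h' <;> simp_all

/-- The exponent of the initial term of `D_I^{(k)}`: the antidiagonal term of the minor of the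
stacked matrix in the rows `k, …, k + p - 1`. -/
def initExp (I : Fin p → Fin n) (k : ℕ) : ZVar n p →₀ ℕ :=
  rowExp (fun m => k + m.rev) I

theorem not_degRevLexLT_initExp_rowExp {P : Fin p → ℕ} {I : Fin p → Fin n} {k : ℕ}
    (hI : StrictMono I) (hP : Function.Injective P)
    (hsum : ∑ m, P m = ∑ m : Fin p, (k + (m.rev : ℕ))) :
    ¬ DegRevLexLT (initExp I k) (rowExp P I) := by
  intro h
  obtain ⟨s, hne, hs⟩ := exists_of_degRevLexLT_rowExp hI.injective h
  have hrev : ∀ {a b : Fin p}, k + (a.rev : ℕ) < k + b.rev ↔ b < a := by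
    simp only [add_lt_add_iff_left, Fin.val_fin_lt, Fin.rev_lt_rev, implies_true]
  refine (sum_lt_sum_add_rev hP (fun m => ?_) (s := s) fun m hm => ?_).ne hsum
  · by_contra! hm
    have hPm := (hs m (P m) (Or.inl (by omega))).2 rfl
    omega
  · rcases lt_trichotomy m s with hms | rfl | hsm
    · have hPm := (hs m _ (Or.inl (hrev.2 hms))).1 rfl
      exact (hrev.2 hms).ne (hm.symm.trans hPm)
    · exact hne hm
    · exact (hrev.2 hsm).ne ((hs m _ (Or.inr ⟨rfl, hI hsm⟩)).2 hm)

/-- The rows of the factors of the initial term of `D_I^{(k)}`, reduced modulo `p`. -/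
def initPerm (p k : ℕ) [NeZero p] : Equiv.Perm (Fin p) :=
  Fin.revPerm.trans (Equiv.addLeft (Fin.ofNat p k))

theorem val_initPerm (k : ℕ) (m : Fin p) : (initPerm p k m : ℕ) = (k + m.rev) % p := by
  rw [initPerm, Equiv.trans_apply, Fin.revPerm_apply, Equiv.coe_addLeft, Fin.val_add,
    Fin.val_ofNat, Nat.mod_add_mod]

/-- The coefficient of the initial term of `D_I^{(k)}`. -/
def initSign (p k : ℕ) [NeZero p] : ℂ := ((Equiv.Perm.sign (initPerm p k) : ℤ) : ℂ)

theorem initSign_ne_zero (k : ℕ) : initSign p k ≠ 0 :=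
  Int.cast_ne_zero.2 (Units.ne_zero _)

omit [NeZero p] in
theorem mul_add_perm_injective (τ : Equiv.Perm (Fin p)) (l : Fin p → ℕ) :
    Function.Injective fun m => p * l m + (τ m : ℕ) := by
  intro a b h
  have hmod : (p * l a + (τ a : ℕ)) % p = (p * l b + (τ b : ℕ)) % p := congrArg (· % p) h
  rw [Nat.mul_add_mod, Nat.mul_add_mod, Nat.mod_eq_of_lt (τ a).2, Nat.mod_eq_of_lt (τ b).2] at hmod
  exact τ.injective (Fin.ext hmod)

theorem sum_mul_add_perm_eq_iff (τ : Equiv.Perm (Fin p)) (l : Fin p → ℕ) (k : ℕ) :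
    ∑ m, (p * l m + τ m) = ∑ m : Fin p, (k + (m.rev : ℕ)) ↔ ∑ m, l m = k := by
  have hτ : ∑ m, (τ m : ℕ) = ∑ m : Fin p, (m : ℕ) := Equiv.sum_comp τ (fun m => (m : ℕ))
  have hrev : ∑ m : Fin p, (m.rev : ℕ) = ∑ m : Fin p, (m : ℕ) :=
    Equiv.sum_comp Fin.revPerm (fun m => (m : ℕ))
  rw [Finset.sum_add_distrib, Finset.sum_add_distrib, hτ, hrev, ← Finset.mul_sum,
    Finset.sum_const, Finset.card_univ, Fintype.card_fin, smul_eq_mul, add_left_inj,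
    Nat.mul_right_inj (NeZero.ne p)]

theorem mul_add_perm_eq_add_rev_iff {τ : Equiv.Perm (Fin p)} {l : Fin p → ℕ} {k : ℕ} :
    (fun m => p * l m + (τ m : ℕ)) = (fun m => k + (m.rev : ℕ)) ↔
      τ = initPerm p k ∧ l = fun m => (k + (m.rev : ℕ)) / p := by
  constructor
  · intro h
    have hm : ∀ m, p * l m + (τ m : ℕ) = k + m.rev := congrFun h
    refine ⟨Equiv.ext fun m => Fin.ext ?_, funext fun m => ?_⟩
    · rw [val_initPerm, ← hm m, Nat.mul_add_mod, Nat.mod_eq_of_lt (τ m).2]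
    · rw [← hm m, Nat.mul_add_div (NeZero.pos p), Nat.div_eq_of_lt (τ m).2, add_zero]
  · rintro ⟨rfl, rfl⟩
    funext m
    rw [val_initPerm, Nat.div_add_mod]

theorem plueckerD_eq_sum (I : Fin p → Fin n) (k : ℕ) :
    plueckerD I k =
      ∑ x ∈ (Finset.univ : Finset (Equiv.Perm (Fin p))) ×ˢ Finset.finsuppAntidiag Finset.univ k,
        MvPolynomial.monomial (rowExp (fun m => p * x.2 m + x.1 m) I)
          ((Equiv.Perm.sign x.1 : ℤ) : ℂ) := by
  classical
  rw [plueckerD, Matrix.det_apply, map_sum, Finset.sum_product]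
  refine Finset.sum_congr rfl fun τ _ => ?_
  rw [Units.smul_def, map_zsmul, PowerSeries.coeff_prod, Finset.smul_sum]
  refine Finset.sum_congr rfl fun l _ => ?_
  have hprod : ∏ m, PowerSeries.coeff (l m) ((zMatrix n p).submatrix id I (τ m) m) =
      MvPolynomial.monomial (rowExp (fun m => p * l m + τ m) I) (1 : ℂ) := by
    rw [rowExp, MvPolynomial.monomial_sum_one]
    refine Finset.prod_congr rfl fun m _ => ?_
    rw [rowVar_mul_add, Matrix.submatrix_apply, zMatrix, Matrix.of_apply, PowerSeries.coeff_mk]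
    rfl
  rw [hprod, ← Int.cast_smul_eq_zsmul ℂ, MvPolynomial.smul_monomial, smul_eq_mul, mul_one]

theorem coeff_initExp_plueckerD {I : Fin p → Fin n} (hI : Function.Injective I) (k : ℕ) :
    (plueckerD I k).coeff (initExp I k) = initSign p k := by
  let l : Fin p →₀ ℕ := Finsupp.equivFunOnFinite.symm fun m => (k + (m.rev : ℕ)) / p
  have hrows : (fun m => p * l m + (initPerm p k m : ℕ)) = fun m => k + (m.rev : ℕ) :=
    mul_add_perm_eq_add_rev_iff.2 ⟨rfl, rfl⟩
  have hl : (initPerm p k, l) ∈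
      (Finset.univ ×ˢ Finset.finsuppAntidiag Finset.univ k : Finset (_ × (Fin p →₀ ℕ))) := by
    refine Finset.mem_product.2 ⟨Finset.mem_univ _, Finset.mem_finsuppAntidiag.2
      ⟨(sum_mul_add_perm_eq_iff (initPerm p k) l k).1 ?_, Finset.subset_univ _⟩⟩
    exact Finset.sum_congr rfl fun m _ => congrFun hrows m
  rw [plueckerD_eq_sum, MvPolynomial.coeff_sum, Finset.sum_eq_single_of_mem _ hl]
  · rw [MvPolynomial.coeff_monomial, initSign]
    exact if_pos (congrArg (rowExp · I) hrows)
  · rintro ⟨τ, l'⟩ - hne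
    rw [MvPolynomial.coeff_monomial, if_neg]
    intro h
    obtain ⟨rfl, hl'⟩ := mul_add_perm_eq_add_rev_iff.1 (rowExp_injective hI h)
    exact hne (Prod.ext rfl (DFunLike.coe_injective hl'))

theorem isLeading_plueckerD {I : Fin p → Fin n} (hI : StrictMono I) (k : ℕ) :
    IsLeading degRevLexKey (plueckerD I k) (initExp I k) := by
  classical
  refine ⟨?_, fun e he hne => ?_⟩
  · rw [MvPolynomial.mem_support_iff, coeff_initExp_plueckerD hI.injective]
    exact initSign_ne_zero k
  · rw [MvPolynomial.mem_support_iff, plueckerD_eq_sum, MvPolynomial.coeff_sum] at he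
    obtain ⟨⟨τ, l⟩, hl, he⟩ := Finset.exists_ne_zero_of_sum_ne_zero he
    obtain rfl : rowExp (fun m => p * l m + τ m) I = e := by
      by_contra h
      rw [MvPolynomial.coeff_monomial] at he
      exact he (if_neg h)
    have hsum := (sum_mul_add_perm_eq_iff τ l k).2
      (Finset.mem_finsuppAntidiag.1 (Finset.mem_product.1 hl).2).1
    refine (degRevLexKey_injective.ne hne).lt_of_le (le_of_not_gt fun h => ?_)
    exact not_degRevLexLT_initExp_rowExp hI (mul_add_perm_injective τ l) hsum (degRevLexLT_iff.2 h)

theorem coe_initialD {I : Fin p → Fin n} (hI : StrictMono I) (k : ℕ) :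
    (initialD I k : MvPolynomial (ZVar n p) ℂ) =
      MvPolynomial.monomial (initExp I k) (initSign p k) := by
  rw [← coeff_initExp_plueckerD hI.injective k]
  exact (isLeading_plueckerD hI k).initialTerm_eq degRevLexLT_iff

end Rows

section RowOperations

variable {R : Type*} [CommRing R]

theorem det_fromRows_mul_add {S T : Type*} [Fintype S] [Fintype T] [DecidableEq S] [DecidableEq T]
    (A : Matrix S (S ⊕ T) R) (B : Matrix T (S ⊕ T) R) (N : Matrix T S R) :
    (A.fromRows (N * A + B)).det = (A.fromRows B).det := by
  have h : Matrix.fromBlocks 1 0 N 1 * A.fromRows B = A.fromRows (N * A + B) := by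
    rw [Matrix.fromBlocks_mul_fromRows, Matrix.one_mul, Matrix.zero_mul, add_zero, Matrix.one_mul]
  rw [← h, Matrix.det_mul, Matrix.det_fromBlocks_zero₁₂, Matrix.det_one, Matrix.det_one, one_mul,
    one_mul]

theorem prod_dvd_det_of_dvd {ι : Type*} [Fintype ι] [DecidableEq ι] {M : Matrix ι ι R} {v : ι → R}
    (h : ∀ i j, v i ∣ M i j) : ∏ i, v i ∣ M.det := by
  choose C hC using h
  have hM : M = Matrix.of fun i j => v i * C i j := by
    ext i j
    exact hC i j
  rw [hM]
  exact ⟨_, Matrix.det_mul_column v (Matrix.of C)⟩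

theorem card_add_card_le_add_card_filter_mem_range {S T ρ : Type*} [Fintype S] [Fintype T]
    [Fintype ρ] {f : S → ρ} {g : T → ρ} (hf : Function.Injective f) (hg : Function.Injective g)
    [DecidablePred fun t => g t ∈ Set.range f] :
    Fintype.card S + Fintype.card T ≤
      Fintype.card ρ + (Finset.univ.filter fun t => g t ∈ Set.range f).card := by
  classical
  have hinter : Finset.univ.image f ∩ Finset.univ.image g =
      (Finset.univ.filter fun t => g t ∈ Set.range f).image g := by
    ext r
    simp only [Finset.mem_inter, Finset.mem_image, Finset.mem_filter, Finset.mem_univ, true_and,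
      Set.mem_range]
    constructor
    · rintro ⟨hs, t, rfl⟩
      exact ⟨t, hs, rfl⟩
    · rintro ⟨t, hs, rfl⟩
      exact ⟨hs, t, rfl⟩
  rw [← Finset.card_univ (α := S), ← Finset.card_univ (α := T),
    ← Finset.card_image_of_injective Finset.univ hf,
    ← Finset.card_image_of_injective Finset.univ hg,
    ← Finset.card_union_add_card_inter, hinter, Finset.card_image_of_injective _ hg]
  exact Nat.add_le_add_right (Finset.card_le_univ _) _

theorem pow_dvd_det_fromRows_of_dvd_sub {S T ρ : Type*} [Fintype S] [Fintype T] [Fintype ρ]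
    [DecidableEq S] [DecidableEq T] {A B : Matrix ρ (S ⊕ T) R} {h : R}
    (hAB : ∀ r c, h ∣ B r c - A r c) {f : S → ρ} {g : T → ρ} (hf : Function.Injective f)
    (hg : Function.Injective g) {c : ℕ}
    (hc : Fintype.card ρ + c ≤ Fintype.card S + Fintype.card T) :
    h ^ c ∣ ((A.submatrix f id).fromRows (B.submatrix g id)).det := by
  classical
  -- Subtracting row `f s` of `A` from row `g t` of `B` whenever `g t = f s` makes the difference
  -- divisible by `h`; at least `c` rows allow this.
  let N : Matrix T S R := Matrix.of fun t s => if g t = f s then -1 else 0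
  let v : S ⊕ T → R := Sum.elim (fun _ => 1) fun t => if g t ∈ Set.range f then h else 1
  rw [← det_fromRows_mul_add _ _ N]
  have hv : ∏ i, v i = h ^ (Finset.univ.filter fun t => g t ∈ Set.range f).card := by
    simp only [v, Fintype.prod_sum_type, Sum.elim_inl, Sum.elim_inr, Finset.prod_const_one, one_mul,
      Finset.prod_ite, Finset.prod_const, mul_one]
  have hcard := card_add_card_le_add_card_filter_mem_range hf hg
  refine (pow_dvd_pow h (show c ≤ _ by omega)).trans (hv ▸ prod_dvd_det_of_dvd ?_)
  rintro (s | t) j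
  · exact one_dvd _
  · simp only [v, Sum.elim_inr]
    split_ifs with ht
    · obtain ⟨s, hs⟩ := ht
      have hrow : (N * A.submatrix f id + B.submatrix g id) t j = B (g t) j - A (g t) j := by
        simp only [N, Matrix.add_apply, Matrix.mul_apply, Matrix.of_apply, Matrix.submatrix_apply,
          ← hs, hf.eq_iff, id, ite_mul, neg_mul, one_mul, zero_mul, Finset.sum_ite_eq,
          Finset.mem_univ, if_true]
        ring
      rw [Matrix.fromRows_apply_inr, hrow]
      exact hAB _ _
    · exact one_dvd _

end RowOperations

section Exchange

variable {ι κ : Type*} {P Q : ι → Prop} [DecidablePred P] [DecidablePred Q]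

/-- The tuple `I` with the entries at the positions in `P` replaced by those of `f`. -/
def replaceOn (f : {m // P m} → κ) (I : ι → κ) (m : ι) : κ :=
  if h : P m then f ⟨m, h⟩ else I m

@[to_additive]
theorem prod_replaceOn [Fintype ι] {M : Type*} [CommMonoid M] (F : ι → κ → M)
    (f : {m // P m} → κ) (I : ι → κ) :
    ∏ m, F m (replaceOn f I m) = (∏ x : {m // P m}, F x (f x)) * ∏ x : {m // ¬ P m}, F x (I x) := by
  rw [← Fintype.prod_subtype_mul_prod_subtype P]
  congr 1 <;> refine Finset.prod_congr rfl fun x _ => ?_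
  · rw [replaceOn, dif_pos x.2]
  · rw [replaceOn, dif_neg x.2]

theorem replaceOn_comp_perm (I : ι → κ) (τ : Equiv.Perm {m // P m}) :
    replaceOn (fun x => I (τ x)) I = I ∘ Equiv.Perm.ofSubtype τ := by
  funext m
  rw [replaceOn, Function.comp_apply]
  split_ifs with h
  · rw [Equiv.Perm.ofSubtype_apply_of_mem τ h]
  · rw [Equiv.Perm.ofSubtype_apply_of_not_mem τ h]

variable (P Q) in
/-- The entries that take part in an exchange between the tuples `I` and `J`: those of `I` at the
positions in `P` and those of `J` at the positions in `Q`. -/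
def exchangeCol (I J : ι → κ) : {m // P m} ⊕ {m // Q m} → κ :=
  Sum.elim (fun m => I m) (fun m => J m)

variable (I J : ι → κ) (π : Equiv.Perm ({m // P m} ⊕ {m // Q m}))

/-- The tuple `I` after a permutation of the exchanged entries. -/
def exchangeLeft : ι → κ := replaceOn (fun x => exchangeCol P Q I J (π (Sum.inl x))) I

/-- The tuple `J` after a permutation of the exchanged entries. -/
def exchangeRight : ι → κ := replaceOn (fun x => exchangeCol P Q I J (π (Sum.inr x))) J

omit [DecidablePred Q] in
theorem exchangeLeft_sumCongr (τ₁ : Equiv.Perm {m // P m}) (τ₂ : Equiv.Perm {m // Q m}) :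
    exchangeLeft I J (Equiv.sumCongr τ₁ τ₂) = I ∘ Equiv.Perm.ofSubtype τ₁ :=
  replaceOn_comp_perm I τ₁

omit [DecidablePred P] in
theorem exchangeRight_sumCongr (τ₁ : Equiv.Perm {m // P m}) (τ₂ : Equiv.Perm {m // Q m}) :
    exchangeRight I J (Equiv.sumCongr τ₁ τ₂) = J ∘ Equiv.Perm.ofSubtype τ₂ :=
  replaceOn_comp_perm J τ₂

section Sums

variable [Fintype ι] {M : Type*} [AddCommMonoid M]

theorem sum_exchangeLeft_add_sum_exchangeRight (w : κ → M) :
    ∑ m, w (exchangeLeft I J π m) + ∑ m, w (exchangeRight I J π m) =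
      ∑ m, w (I m) + ∑ m, w (J m) := by
  have hI := Fintype.sum_subtype_add_sum_subtype P fun m => w (I m)
  have hJ := Fintype.sum_subtype_add_sum_subtype Q fun m => w (J m)
  have hπ := Equiv.sum_comp π fun x => w (exchangeCol P Q I J x)
  rw [Fintype.sum_sum_type, Fintype.sum_sum_type] at hπ
  rw [exchangeLeft, exchangeRight, sum_replaceOn fun _ => w, sum_replaceOn fun _ => w,
    add_add_add_comm, hπ, add_add_add_comm, ← hI, ← hJ]
  rfl

omit [DecidablePred Q] in
theorem sum_exchangeLeft_lt [LinearOrder M] [IsOrderedCancelAddMonoid M] {w : κ → M}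
    (hlt : ∀ a b, P a → Q b → w (J b) < w (I a))
    (hπ : ¬ Set.MapsTo π (Set.range Sum.inl) (Set.range Sum.inl)) :
    ∑ m, w (exchangeLeft I J π m) < ∑ m, w (I m) := by
  classical
  let s : Finset ({m // P m} ⊕ {m // Q m}) := Finset.univ.map Function.Embedding.inl
  have hmem : ∀ x, x ∈ s ↔ x ∈ Set.range Sum.inl := by simp [s]
  have hsum : ∑ x ∈ s.map π.toEmbedding, w (exchangeCol P Q I J x) <
      ∑ x ∈ s, w (exchangeCol P Q I J x) := by
    refine sum_lt_sum_of_card_eq_of_ne (Finset.card_map _) (fun h => hπ fun x hx => ?_) ?_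
    · rw [← hmem, ← h]
      exact Finset.mem_map_of_mem π.toEmbedding ((hmem x).2 hx)
    · rintro (a | b) ha y hy
      · exact absurd ((hmem _).2 ⟨a, rfl⟩) (Finset.mem_sdiff.1 ha).2
      · obtain ⟨a, rfl⟩ := (hmem y).1 hy
        exact hlt a b a.2 b.2
  rw [Finset.sum_map, Finset.sum_map, Finset.sum_map] at hsum
  rw [exchangeLeft, sum_replaceOn fun _ => w,
    ← Fintype.sum_subtype_add_sum_subtype P fun m => w (I m)]
  exact add_lt_add_left hsum _

end Sums

section Determinants

variable [Fintype ι] [DecidableEq ι] {R : Type*} [CommRing R]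

/-- The Laplace expansion of both minors along the exchanged columns turns the antisymmetrization
over these columns into determinants. -/
theorem sum_sign_mul_det_exchange (A B : Matrix ι κ R) :
    ∑ π : Equiv.Perm ({m // P m} ⊕ {m // Q m}), ((Equiv.Perm.sign π : ℤ) : R) *
      ((A.submatrix id (exchangeLeft I J π)).det * (B.submatrix id (exchangeRight I J π)).det) =
    ∑ τ₁ : Equiv.Perm ι, ∑ τ₂ : Equiv.Perm ι,
      (((Equiv.Perm.sign τ₁ : ℤ) : R) * ((Equiv.Perm.sign τ₂ : ℤ) : R) *
        (∏ x : {m // ¬ P m}, A (τ₁ x) (I x)) * ∏ x : {m // ¬ Q m}, B (τ₂ x) (J x)) *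
      (((A.submatrix id (exchangeCol P Q I J)).submatrix (fun x : {m // P m} => τ₁ x) id).fromRows
        ((B.submatrix id (exchangeCol P Q I J)).submatrix
          (fun x : {m // Q m} => τ₂ x) id)).det := by
  simp_rw [Matrix.det_apply' (Matrix.submatrix _ _ _), Finset.sum_mul_sum, Finset.mul_sum]
  rw [Finset.sum_comm]
  refine Finset.sum_congr rfl fun τ₁ _ => ?_
  rw [Finset.sum_comm]
  refine Finset.sum_congr rfl fun τ₂ _ => ?_
  rw [← Matrix.det_transpose, Matrix.det_apply', Finset.mul_sum]
  refine Finset.sum_congr rfl fun π _ => ?_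
  simp only [Matrix.submatrix_apply, id, exchangeLeft, exchangeRight, Fintype.prod_sum_type,
    Matrix.transpose_apply, Matrix.fromRows_apply_inl, Matrix.fromRows_apply_inr]
  rw [prod_replaceOn fun m c => A (τ₁ m) c, prod_replaceOn fun m c => B (τ₂ m) c]
  ring

theorem pow_dvd_sum_sign_mul_det_exchange {A B : Matrix ι κ R} {h : R}
    (hAB : ∀ r c, h ∣ B r c - A r c) {c : ℕ}
    (hc : Fintype.card ι + c ≤ Fintype.card {m // P m} + Fintype.card {m // Q m}) :
    h ^ c ∣ ∑ π : Equiv.Perm ({m // P m} ⊕ {m // Q m}), ((Equiv.Perm.sign π : ℤ) : R) *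
      ((A.submatrix id (exchangeLeft I J π)).det *
        (B.submatrix id (exchangeRight I J π)).det) := by
  rw [sum_sign_mul_det_exchange]
  exact Finset.dvd_sum fun τ₁ _ => Finset.dvd_sum fun τ₂ _ => Dvd.dvd.mul_left
    (pow_dvd_det_fromRows_of_dvd_sub (fun _ _ => hAB _ _)
      (τ₁.injective.comp Subtype.val_injective) (τ₂.injective.comp Subtype.val_injective) hc) _

end Determinants

end Exchange

section QuadraticRelations

open Polynomial in
theorem coeff_X_mul_derivative_sub_C_mul {R : Type*} [CommRing R] (f : R[X]) (r : R) (y : ℕ) :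
    (X * derivative f - C r * f).coeff y = ((y : R) - r) * f.coeff y := by
  rw [coeff_sub, coeff_C_mul, sub_mul]
  congr 1
  rcases y with _ | y
  · rw [coeff_X_mul_zero, Nat.cast_zero, zero_mul]
  · rw [coeff_X_mul, coeff_derivative, Nat.cast_succ, mul_comm]

open Polynomial in
theorem sum_prod_sub_mul_coeff_eq_zero {R : Type*} [CommRing R] (w : ℕ → R) {N d : ℕ} {f : R[X]}
    (hN : f.natDegree ≤ N) (hf : (X - 1) ^ (d + 1) ∣ f) :
    ∑ y ∈ Finset.range (N + 1), (∏ j ∈ Finset.range d, ((y : R) - w j)) * f.coeff y = 0 := by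
  induction d generalizing f with
  | zero =>
    have heval : f.eval 1 = 0 := by
      obtain ⟨g, rfl⟩ := hf
      rw [eval_mul, zero_add, pow_one, eval_sub, eval_X, eval_one, sub_self, zero_mul]
    rw [eval_eq_sum_range' (Nat.lt_succ_of_le hN)] at heval
    simpa only [Finset.range_zero, Finset.prod_empty, one_mul, one_pow, mul_one] using heval
  | succ d ih =>
    -- The operator `X d/dX - w d` multiplies the coefficient of `X ^ y` by `y - w d` and lowers
    -- the order of vanishing at `1` by at most one.
    have hdeg : (X * derivative f - C (w d) * f).natDegree ≤ N := by
      rw [natDegree_le_iff_coeff_eq_zero]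
      intro y hy
      rw [coeff_X_mul_derivative_sub_C_mul, coeff_eq_zero_of_natDegree_lt (hN.trans_lt hy),
        mul_zero]
    have hdvd : (X - 1) ^ (d + 1) ∣ X * derivative f - C (w d) * f :=
      dvd_sub (Dvd.dvd.mul_left (pow_sub_one_dvd_derivative_of_pow_dvd hf) _)
        (Dvd.dvd.mul_left ((pow_dvd_pow _ d.succ.le_succ).trans hf) _)
    rw [← ih hdeg hdvd]
    refine Finset.sum_congr rfl fun y _ => ?_
    rw [coeff_X_mul_derivative_sub_C_mul, Finset.prod_range_succ, mul_assoc]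

section Dilation

variable {R : Type*} [CommRing R]

/-- The coefficient of `t ^ K` in `f(t) g(λ t)`, as a polynomial in `λ`. -/
def dilatedCoeff (f g : PowerSeries R) (K : ℕ) : Polynomial R :=
  PowerSeries.coeff K (PowerSeries.map Polynomial.C f *
    PowerSeries.rescale Polynomial.X (PowerSeries.map Polynomial.C g))

theorem coeff_dilatedCoeff (f g : PowerSeries R) (K y : ℕ) :
    (dilatedCoeff f g K).coeff y =
      if y ≤ K then PowerSeries.coeff (K - y) f * PowerSeries.coeff y g else 0 := by
  have hterm : ∀ x z : ℕ, Polynomial.coeff (PowerSeries.coeff x (PowerSeries.map Polynomial.C f) *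
      PowerSeries.coeff z (PowerSeries.rescale Polynomial.X (PowerSeries.map Polynomial.C g))) y =
      if z = y then PowerSeries.coeff x f * PowerSeries.coeff z g else 0 := by
    intro x z
    rw [PowerSeries.coeff_rescale, PowerSeries.coeff_map, PowerSeries.coeff_map,
      Polynomial.coeff_C_mul, Polynomial.X_pow_mul_C, Polynomial.coeff_C_mul_X_pow, mul_ite,
      mul_zero]
    simp only [eq_comm]
  rw [dilatedCoeff, PowerSeries.coeff_mul, Polynomial.finsetSum_coeff,
    ← Finset.Nat.sum_antidiagonal_swap, Finset.Nat.sum_antidiagonal_eq_sum_range_succ_mk]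
  simp only [Prod.swap_prod_mk, hterm, Finset.sum_ite_eq', Finset.mem_range, Nat.lt_succ_iff]

theorem natDegree_dilatedCoeff_le (f g : PowerSeries R) (K : ℕ) :
    (dilatedCoeff f g K).natDegree ≤ K := by
  rw [Polynomial.natDegree_le_iff_coeff_eq_zero]
  intro y hy
  rw [coeff_dilatedCoeff, if_neg hy.not_ge]

theorem C_X_sub_one_dvd_rescale_map_sub_map (f : PowerSeries R) :
    PowerSeries.C (Polynomial.X - 1) ∣
      PowerSeries.rescale Polynomial.X (PowerSeries.map Polynomial.C f) -
        PowerSeries.map Polynomial.C f := by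
  refine ⟨PowerSeries.mk fun k => (∑ i ∈ Finset.range k, Polynomial.X ^ i) *
    Polynomial.C (PowerSeries.coeff k f), ?_⟩
  ext1 k
  rw [map_sub, PowerSeries.coeff_rescale, PowerSeries.coeff_map, PowerSeries.coeff_C_mul,
    PowerSeries.coeff_mk, ← mul_assoc, mul_geom_sum, sub_mul, one_mul]

variable {ι κ : Type*} [Fintype ι] [DecidableEq ι] {P Q : ι → Prop} [DecidablePred P]
  [DecidablePred Q]

theorem pow_dvd_sum_sign_mul_dilatedCoeff (A : Matrix ι κ (PowerSeries R)) (I J : ι → κ) (K : ℕ)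
    {c : ℕ} (hc : Fintype.card ι + c ≤ Fintype.card {m // P m} + Fintype.card {m // Q m}) :
    (Polynomial.X - 1) ^ c ∣ ∑ π : Equiv.Perm ({m // P m} ⊕ {m // Q m}),
      ((Equiv.Perm.sign π : ℤ) : Polynomial R) *
        dilatedCoeff (A.submatrix id (exchangeLeft I J π)).det
          (A.submatrix id (exchangeRight I J π)).det K := by
  have hdet (g : PowerSeries R →+* PowerSeries (Polynomial R)) (f : ι → κ) :
      ((A.map g).submatrix id f).det = g (A.submatrix id f).det :=
    (RingHom.map_det g _).symm
  obtain ⟨H, hH⟩ := pow_dvd_sum_sign_mul_det_exchange I J (h := PowerSeries.C (Polynomial.X - 1))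
    (A := A.map (PowerSeries.map Polynomial.C))
    (B := A.map ((PowerSeries.rescale Polynomial.X).comp (PowerSeries.map Polynomial.C)))
    (fun r c => C_X_sub_one_dvd_rescale_map_sub_map (A r c)) hc
  refine ⟨PowerSeries.coeff K H, ?_⟩
  rw [← PowerSeries.coeff_C_mul, map_pow, ← hH, map_sum]
  refine Finset.sum_congr rfl fun π _ => ?_
  rw [← zsmul_eq_mul, ← zsmul_eq_mul, map_zsmul, hdet, hdet, dilatedCoeff, RingHom.comp_apply]

theorem sum_prod_sub_mul_sum_sign_mul_coeff_det_eq_zero (A : Matrix ι κ (PowerSeries R))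
    (I J : ι → κ) (w : ℕ → R) (K : ℕ) {d : ℕ}
    (hd : Fintype.card ι + (d + 1) ≤ Fintype.card {m // P m} + Fintype.card {m // Q m}) :
    ∑ y ∈ Finset.range (K + 1), (∏ j ∈ Finset.range d, ((y : R) - w j)) *
      ∑ π : Equiv.Perm ({m // P m} ⊕ {m // Q m}), ((Equiv.Perm.sign π : ℤ) : R) *
        (PowerSeries.coeff (K - y) (A.submatrix id (exchangeLeft I J π)).det *
          PowerSeries.coeff y (A.submatrix id (exchangeRight I J π)).det) = 0 := by
  have hdeg : (∑ π : Equiv.Perm ({m // P m} ⊕ {m // Q m}),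
      ((Equiv.Perm.sign π : ℤ) : Polynomial R) *
        dilatedCoeff (A.submatrix id (exchangeLeft I J π)).det
          (A.submatrix id (exchangeRight I J π)).det K).natDegree ≤ K := by
    refine Polynomial.natDegree_sum_le_of_forall_le _ _ fun π _ => ?_
    rw [← zsmul_eq_mul]
    exact (Polynomial.natDegree_smul_le _ _).trans (natDegree_dilatedCoeff_le _ _ K)
  rw [← sum_prod_sub_mul_coeff_eq_zero w hdeg (pow_dvd_sum_sign_mul_dilatedCoeff A I J K hd)]
  refine Finset.sum_congr rfl fun y hy => ?_
  rw [Polynomial.finsetSum_coeff]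
  congr 1
  refine Finset.sum_congr rfl fun π _ => ?_
  rw [← zsmul_eq_mul, ← zsmul_eq_mul, Polynomial.coeff_smul, coeff_dilatedCoeff,
    if_pos (Nat.le_of_lt_succ (Finset.mem_range.1 hy))]

end Dilation

end QuadraticRelations

section PairStraightening

/-- The span of the products `f x' * f y'` whose weights have the same sum as those of `x` and `y`
and whose first weight is smaller than that of `x`. If `w x ≤ w y`, the weights of `x'` and `y'`
are further apart than those of `x` and `y`. -/
def spreadSpan {ι A : Type*} (R : Type*) [CommSemiring R] [CommSemiring A] [Algebra R A]
    (f : ι → A) (w : ι → ℕ) (x y : ι) : Submodule R A :=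
  Submodule.span R {g | ∃ x' y', w x' + w y' = w x + w y ∧ w x' < w x ∧ g = f x' * f y'}

theorem mul_mem_spreadSpan {ι A R : Type*} [CommSemiring R] [CommSemiring A] [Algebra R A]
    {f : ι → A} {w : ι → ℕ} {x y x' y' : ι} (hsum : w x' + w y' = w x + w y)
    (hlt : w x' < w x ∨ w y' < w x) : f x' * f y' ∈ spreadSpan R f w x y := by
  rcases hlt with hlt | hlt
  · exact Submodule.subset_span ⟨x', y', hsum, hlt, rfl⟩
  · exact Submodule.subset_span ⟨y', x', (Nat.add_comm _ _).trans hsum, hlt, mul_comm _ _⟩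

theorem mem_of_sum_prod_sub_smul_eq_zero {𝕜 M : Type*} [Field 𝕜] [CharZero 𝕜] [AddCommGroup M]
    [Module 𝕜 M] {V : Submodule 𝕜 M} {E : ℕ → M} {a b N : ℕ} (hb : b ≤ N)
    (hE : ∀ y ≤ N, y < a ∨ b < y → E y ∈ V)
    (hsum : ∑ y ∈ Finset.range (N + 1),
      (∏ l ∈ Finset.range (b - a), ((y : 𝕜) - ((a + l : ℕ) : 𝕜))) • E y = 0) : E b ∈ V := by
  rw [← Finset.add_sum_erase _ _ (Finset.mem_range.2 (Nat.lt_succ_of_le hb))] at hsum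
  have hb0 : ∏ l ∈ Finset.range (b - a), ((b : 𝕜) - ((a + l : ℕ) : 𝕜)) ≠ 0 := by
    refine Finset.prod_ne_zero_iff.2 fun l hl => sub_ne_zero.2 (Nat.cast_injective.ne ?_)
    rw [Finset.mem_range] at hl
    omega
  refine (V.smul_mem_iff hb0).1 ?_
  rw [eq_neg_of_add_eq_zero_left hsum]
  refine V.neg_mem (V.sum_mem fun y hy => ?_)
  rw [Finset.mem_erase, Finset.mem_range, Nat.lt_succ_iff] at hy
  by_cases hya : y < a ∨ b < y
  · exact V.smul_mem _ (hE y hy.2 hya)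
  · rw [Finset.prod_eq_zero (i := y - a), zero_smul]
    · exact V.zero_mem
    · rw [Finset.mem_range]
      omega
    · rw [sub_eq_zero]
      congr 1
      omega

variable {n p : ℕ}

theorem plueckerD_comp_perm (I : Fin p → Fin n) (τ : Equiv.Perm (Fin p)) (k : ℕ) :
    plueckerD (I ∘ τ) k =
      ((Equiv.Perm.sign τ : ℤ) : MvPolynomial (ZVar n p) ℂ) * plueckerD I k := by
  have h := Matrix.det_permute' τ ((zMatrix n p).submatrix id I)
  rw [Matrix.submatrix_submatrix, Function.comp_id] at h
  rw [plueckerD, plueckerD, h, ← zsmul_eq_mul, map_zsmul, zsmul_eq_mul]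

section Exchange

variable {P Q : Fin p → Prop} [DecidablePred P] [DecidablePred Q] {I J : Fin p → Fin n} {a b : ℕ}

theorem sign_mul_exchange_of_mapsTo {π : Equiv.Perm ({m // P m} ⊕ {m // Q m})}
    (hπ : Set.MapsTo π (Set.range Sum.inl) (Set.range Sum.inl)) :
    ((Equiv.Perm.sign π : ℤ) : MvPolynomial (ZVar n p) ℂ) *
      (plueckerD (exchangeLeft I J π) a * plueckerD (exchangeRight I J π) b) =
        plueckerD I a * plueckerD J b := by
  obtain ⟨⟨τ₁, τ₂⟩, rfl⟩ := Equiv.Perm.mem_sumCongrHom_range_of_perm_mapsTo_inl hπ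
  rw [Equiv.Perm.sumCongrHom_apply, exchangeLeft_sumCongr, exchangeRight_sumCongr,
    plueckerD_comp_perm, plueckerD_comp_perm, Equiv.Perm.sign_sumCongr, Equiv.Perm.sign_ofSubtype,
    Equiv.Perm.sign_ofSubtype]
  rcases Int.units_eq_one_or (Equiv.Perm.sign τ₁) with h₁ | h₁ <;>
  rcases Int.units_eq_one_or (Equiv.Perm.sign τ₂) with h₂ | h₂ <;> simp [h₁, h₂]

theorem mul_mem_of_sum_sign_mul_exchange_mem {V : Submodule ℂ (MvPolynomial (ZVar n p) ℂ)}
    (hsum : ∑ π : Equiv.Perm ({m // P m} ⊕ {m // Q m}),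
      ((Equiv.Perm.sign π : ℤ) : MvPolynomial (ZVar n p) ℂ) *
        (plueckerD (exchangeLeft I J π) a * plueckerD (exchangeRight I J π) b) ∈ V)
    (hV : ∀ π : Equiv.Perm ({m // P m} ⊕ {m // Q m}),
      ¬ Set.MapsTo π (Set.range Sum.inl) (Set.range Sum.inl) →
        plueckerD (exchangeLeft I J π) a * plueckerD (exchangeRight I J π) b ∈ V) :
    plueckerD I a * plueckerD J b ∈ V := by
  classical
  rw [← Finset.sum_filter_add_sum_filter_not Finset.univ
    fun π : Equiv.Perm ({m // P m} ⊕ {m // Q m}) =>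
      Set.MapsTo π (Set.range Sum.inl) (Set.range Sum.inl)] at hsum
  have hmem := (V.add_mem_iff_left (V.sum_mem fun π hπ => ?_)).1 hsum
  · rw [Finset.sum_congr rfl fun π hπ => sign_mul_exchange_of_mapsTo (Finset.mem_filter.1 hπ).2,
      Finset.sum_const, ← Nat.cast_smul_eq_nsmul ℂ] at hmem
    refine (V.smul_mem_iff (Nat.cast_ne_zero.2 (Finset.card_ne_zero.2 ?_))).1 hmem
    exact ⟨1, Finset.mem_filter.2 ⟨Finset.mem_univ _, fun x hx => hx⟩⟩
  · rw [← zsmul_eq_mul]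
    exact zsmul_mem (hV π (Finset.mem_filter.1 hπ).2) _

end Exchange

/-- The weight of `D_I^{(k)}`: it compares `k` first and the sum of the entries of `I` second. -/
def weight (x : (Fin p → Fin n) × ℕ) : ℕ := (p * n + 1) * x.2 + ∑ m, (x.1 m : ℕ)

theorem weight_lt_of_lt {I I' : Fin p → Fin n} {k k' : ℕ} (h : k' < k) :
    weight (I', k') < weight (I, k) := by
  have hsum : ∑ m, (I' m : ℕ) ≤ p * n := by
    calc ∑ m, (I' m : ℕ) ≤ ∑ _m : Fin p, n := Finset.sum_le_sum fun m _ => (I' m).2.le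
      _ = p * n := by rw [Finset.sum_const, Finset.card_univ, Fintype.card_fin, smul_eq_mul]
  calc weight (I', k') < (p * n + 1) * (k' + 1) := by simp only [weight, mul_add]; omega
    _ ≤ (p * n + 1) * k := Nat.mul_le_mul_left _ h
    _ ≤ weight (I, k) := Nat.le_add_right _ _

variable {P Q : Fin p → Prop} [DecidablePred P] [DecidablePred Q]

theorem weight_exchangeLeft_add_weight_exchangeRight (I J : Fin p → Fin n)
    (π : Equiv.Perm ({m // P m} ⊕ {m // Q m})) {a b x y : ℕ} (hxy : x + y = a + b) :
    weight (exchangeLeft I J π, x) + weight (exchangeRight I J π, y) =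
      weight (I, a) + weight (J, b) := by
  simp only [weight]
  rw [add_add_add_comm, ← mul_add, hxy,
    sum_exchangeLeft_add_sum_exchangeRight I J π fun c => (c : ℕ), mul_add, add_add_add_comm]

theorem plueckerD_mul_plueckerD_mem_spreadSpan_of_card {I J : Fin p → Fin n} {a b : ℕ}
    (hPQ : ∀ x y, P x → Q y → J y < I x)
    (hcard : p + (b - a + 1) ≤ Fintype.card {m // P m} + Fintype.card {m // Q m}) :
    plueckerD I a * plueckerD J b ∈
      spreadSpan ℂ (Function.uncurry plueckerD) weight (I, a) (J, b) := by
  have hrel := sum_prod_sub_mul_sum_sign_mul_coeff_det_eq_zero (zMatrix n p) I J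
    (fun l => ((a + l : ℕ) : MvPolynomial (ZVar n p) ℂ)) (a + b)
    (by rwa [Fintype.card_fin])
  refine mul_mem_of_sum_sign_mul_exchange_mem (P := P) (Q := Q) ?_ fun π hπ => ?_
  · have hmem := mem_of_sum_prod_sub_smul_eq_zero (𝕜 := ℂ) (a := a) (b := b) (N := a + b)
      (V := spreadSpan ℂ (Function.uncurry plueckerD) weight (I, a) (J, b)) (by omega)
      (fun y hy hab => Submodule.sum_mem _ fun π _ => ?_) (by
        simpa only [Algebra.smul_def, map_prod, map_sub, map_natCast] using hrel)
    · simpa only [Nat.add_sub_cancel, plueckerD] using hmem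
    · rw [← zsmul_eq_mul]
      refine zsmul_mem (mul_mem_spreadSpan (x' := (_, _)) (y' := (_, _))
        (weight_exchangeLeft_add_weight_exchangeRight I J π (by omega)) ?_) _
      exact hab.symm.imp (fun _ => weight_lt_of_lt (by omega)) weight_lt_of_lt
  · refine mul_mem_spreadSpan (x' := (_, _)) (y' := (_, _))
      (weight_exchangeLeft_add_weight_exchangeRight I J π rfl) (Or.inl ?_)
    exact Nat.add_lt_add_left (sum_exchangeLeft_lt I J π (w := fun c => (c : ℕ)) hPQ hπ) _

theorem plueckerD_mul_plueckerD_mem_spreadSpan {I J : Fin p → Fin n} (hI : StrictMono I)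
    (hJ : StrictMono J) {a b : ℕ} {i j : Fin p} (hij : (i : ℕ) + (b - a) = j) (hlt : J j < I i) :
    plueckerD I a * plueckerD J b ∈
      spreadSpan ℂ (Function.uncurry plueckerD) weight (I, a) (J, b) := by
  refine plueckerD_mul_plueckerD_mem_spreadSpan_of_card (P := (i ≤ ·)) (Q := (· ≤ j))
    (fun x y hx hy => (hJ.monotone hy).trans_lt (hlt.trans_le (hI.monotone hx))) ?_
  rw [Fintype.card_subtype, Fintype.card_subtype, Finset.filter_le_eq_Ici, Finset.filter_ge_eq_Iic,
    Fin.card_Ici, Fin.card_Iic]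
  omega

end PairStraightening

section MultichainSums

variable {P ι : Type*} [LE P] {F : ι → Finset P}

theorem idealPoint_univ_apply (J : Finset P) (q : P) [Decidable (q ∈ J)] :
    idealPoint Set.univ ∅ J q = if q ∈ J then 1 else 0 := by
  simp [idealPoint, Finsupp.onFinset_apply]

theorem exists_eq_support_sum_idealPoint {s : Multiset ι} (hs : s ≠ 0)
    (hchain : IsChain (fun x y => F x ⊆ F y) {x | x ∈ s}) :
    ∃ x ∈ s, F x = (s.map fun x => idealPoint Set.univ ∅ (F x)).sum.support := by
  classical
  obtain ⟨x, hx, hmax⟩ := Finset.exists_max_image s.toFinset (fun x => (F x).card)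
    (Multiset.toFinset_nonempty.2 hs)
  rw [Multiset.mem_toFinset] at hx
  have hsub : ∀ y ∈ s, F y ⊆ F x := by
    intro y hy
    rcases eq_or_ne x y with rfl | hne
    · exact Finset.Subset.rfl
    rcases hchain hx hy hne with h | h
    · exact (Finset.eq_of_subset_of_card_le h (hmax y (Multiset.mem_toFinset.2 hy))).symm.subset
    · exact h
  refine ⟨x, hx, ?_⟩
  ext q
  rw [Finsupp.mem_support_iff, ← Finsupp.applyAddHom_apply, map_multiset_sum, Multiset.map_map,
    ne_eq, Multiset.sum_eq_zero_iff]
  simp only [Multiset.mem_map, Function.comp_apply, Finsupp.applyAddHom_apply,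
    idealPoint_univ_apply, forall_exists_index, and_imp, forall_apply_eq_imp_iff₂, not_forall,
    ite_eq_right_iff, one_ne_zero, imp_false, not_not]
  exact ⟨fun hq => ⟨x, hx, hq⟩, fun ⟨y, hy, hq⟩ => hsub y hy hq⟩

theorem eq_of_sum_idealPoint_eq (hF : Function.Injective F) {s t : Multiset ι}
    (hs : IsChain (fun x y => F x ⊆ F y) {x | x ∈ s})
    (ht : IsChain (fun x y => F x ⊆ F y) {x | x ∈ t}) (hcard : s.card = t.card)
    (h : (s.map fun x => idealPoint Set.univ ∅ (F x)).sum =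
      (t.map fun x => idealPoint Set.univ ∅ (F x)).sum) : s = t := by
  induction hd : s.card generalizing s t with
  | zero => rw [Multiset.card_eq_zero.1 hd, Multiset.card_eq_zero.1 (hcard.symm.trans hd)]
  | succ d ih =>
    -- The largest member of a chain is the support of its sum.
    obtain ⟨x, hx, hx'⟩ := exists_eq_support_sum_idealPoint
      (Multiset.card_pos.1 (hd ▸ d.succ_pos)) hs
    obtain ⟨y, hy, hy'⟩ := exists_eq_support_sum_idealPoint
      (Multiset.card_pos.1 (hcard ▸ hd ▸ d.succ_pos)) ht
    obtain rfl : x = y := hF (by rw [hx', hy', h])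
    obtain ⟨s, rfl⟩ := Multiset.exists_cons_of_mem hx
    obtain ⟨t, rfl⟩ := Multiset.exists_cons_of_mem hy
    simp only [Multiset.map_cons, Multiset.sum_cons, Multiset.card_cons, add_left_inj,
      add_right_inj] at h hcard hd
    rw [ih (hs.mono fun _ => Multiset.mem_cons_of_mem) (ht.mono fun _ => Multiset.mem_cons_of_mem)
      hcard h hd]

end MultichainSums

section Ideals

variable {n p : ℕ}

theorem add_sub_le_of_strictMono {I : Fin p → Fin n} (hI : StrictMono I) {a b : Fin p}
    (hab : a ≤ b) : (I a : ℕ) + (b - a) ≤ I b := by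
  have hcard : (Finset.Ico a b).card ≤ (Finset.Ico (I a) (I b)).card :=
    Finset.card_le_card_of_injOn I (fun x hx => by
      rw [Finset.coe_Ico, Set.mem_Ico] at hx
      exact Finset.mem_coe.2 (Finset.mem_Ico.2 ⟨hI.monotone hx.1, hI hx.2⟩)) hI.injective.injOn
  rw [Fin.card_Ico, Fin.card_Ico] at hcard
  have hle : (I a : ℕ) ≤ I b := hI.monotone hab
  omega

theorem le_of_strictMono {I : Fin p → Fin n} (hI : StrictMono I) (m : Fin p) : (m : ℕ) ≤ I m := by
  have h := add_sub_le_of_strictMono hI (a := ⟨0, m.pos⟩) (b := m) (Fin.le_def.2 (Nat.zero_le _))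
  simp only at h
  omega

theorem add_lt_of_strictMono {I : Fin p → Fin n} (hI : StrictMono I) (m : Fin p) :
    (I m : ℕ) + p ≤ m + n := by
  have hp := m.pos
  have h := add_sub_le_of_strictMono hI (a := m) (b := ⟨p - 1, by omega⟩)
    (Fin.le_def.2 (by simp only; omega))
  simp only at h
  omega

theorem mem_phi {I : Fin p → Fin n} {k : ℕ} {q : TildeQ n p} :
    q ∈ phi I k ↔ q.i ≤ k ∨ ∃ m : Fin p, q.i + m = k + p ∧ q.j ≤ q.i + I m := by
  rw [phi, Set.Finite.mem_toFinset]
  rfl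

theorem isLowerSet_phi (hpn : p < n) {I : Fin p → Fin n} (hI : StrictMono I) (k : ℕ) :
    IsLowerSet (phi I k : Set (TildeQ n p)) := by
  intro q q' hle hq
  rw [Finset.mem_coe, mem_phi] at hq ⊢
  rw [TildeQ.le_def] at hle
  obtain ⟨i, j, h₁, h₂, h₃, h₄⟩ := q
  obtain ⟨i', j', h₁', h₂', h₃', h₄'⟩ := q'
  simp only at hq hle ⊢
  by_cases hk : i' ≤ k
  · exact Or.inl hk
  have hi' : k + p - i' < p := by
    rcases hq with hq | ⟨m, hm, -⟩ <;> omega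
  have hm'_first := le_of_strictMono hI ⟨k + p - i', hi'⟩
  simp only at hm'_first
  rcases hq with hq | ⟨m, hm, hq⟩
  · refine Or.inr ⟨⟨k + p - i', hi'⟩, by simp only; omega, ?_⟩
    rcases hle with hle | hle | hle <;> omega
  · have hm_last := add_lt_of_strictMono hI m
    refine Or.inr ⟨⟨k + p - i', hi'⟩, by simp only; omega, ?_⟩
    rcases hle with hle | hle | hle
    · have hgap := add_sub_le_of_strictMono hI (a := m) (b := ⟨k + p - i', hi'⟩)
        (Fin.le_def.2 (by simp only; omega))
      simp only at hgap
      omega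
    · omega
    · omega

theorem phi_subset_phi {I J : Fin p → Fin n} {a b : ℕ} (hab : a ≤ b)
    (h : ∀ i j : Fin p, (i : ℕ) + (b - a) = j → I i ≤ J j) : phi I a ⊆ phi J b := by
  intro q hq
  rw [mem_phi] at hq ⊢
  rcases hq with hq | ⟨m, hm, hq⟩
  · exact Or.inl (hq.trans hab)
  · by_cases hqb : q.i ≤ b
    · exact Or.inl hqb
    · refine Or.inr ⟨⟨m + (b - a), by omega⟩, by simp only; omega, ?_⟩
      have hIJ : (I m : ℕ) ≤ J ⟨m + (b - a), by omega⟩ := h m _ rfl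
      omega

theorem le_of_phi_subset_phi (hp : 1 ≤ p) (hpn : p < n) {I J : Fin p → Fin n} {a b : ℕ}
    (h : phi I a ⊆ phi J b) : a ≤ b := by
  by_contra hab
  have hq : (⟨a + p, a + p, by omega, by omega, le_rfl, by omega⟩ : TildeQ n p) ∈ phi I a :=
    mem_phi.2 (Or.inr ⟨⟨0, hp⟩, rfl, Nat.le_add_right _ _⟩)
  rcases mem_phi.1 (h hq) with hb | ⟨m, hm, -⟩ <;> simp only at * <;> omega

theorem apply_le_of_phi_subset_phi {I J : Fin p → Fin n} {a : ℕ} (hJ : StrictMono J)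
    (h : phi I a ⊆ phi J a) (m : Fin p) : I m ≤ J m := by
  by_contra hlt
  rw [Fin.le_def, not_le] at hlt
  have hm_first := le_of_strictMono hJ m
  have hq : (⟨a + p - m, a + p - m + I m, by omega, by omega, by omega, by omega⟩ : TildeQ n p) ∈
      phi I a :=
    mem_phi.2 (Or.inr ⟨m, by simp only; omega, le_rfl⟩)
  rcases mem_phi.1 (h hq) with ha | ⟨m', hm', hj⟩ <;> simp only at *
  · omega
  · obtain rfl : m' = m := Fin.ext (by omega)
    omega

section IsIdealPosition

/-- Whether the position `(i, i + c)` belongs to the order ideal `F`, where the positions with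
`i + c ≤ p`, which do not occur in `TildeQ n p`, are regarded as members of every ideal. -/
def IsIdealPosition (F : Finset (TildeQ n p)) (i c : ℕ) : Prop :=
  i + c ≤ p ∨ ∃ q ∈ F, q.i = i ∧ q.j = i + c

variable {F : Finset (TildeQ n p)}

theorem mem_iff_isIdealPosition {q : TildeQ n p} : q ∈ F ↔ IsIdealPosition F q.i (q.j - q.i) := by
  have hj := q.lt_j
  have hij := q.le
  constructor
  · exact fun hq => Or.inr ⟨q, hq, rfl, by omega⟩
  · rintro (h | ⟨q', hq', hi', hj'⟩)
    · omega
    · obtain rfl : q' = q := TildeQ.ext hi' (by omega)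
      exact hq'

theorem IsIdealPosition.mono (hF : IsLowerSet (F : Set (TildeQ n p))) {i c i' c' : ℕ}
    (h : IsIdealPosition F i c) (hi' : 1 ≤ i') (hc' : c' < n)
    (hle : i' ≤ i ∧ i' + c' ≤ i + c ∨ i' + p ≤ i ∨ i' + c' + (n - p) ≤ i + c) :
    IsIdealPosition F i' c' := by
  by_cases hp : i' + c' ≤ p
  · exact Or.inl hp
  rcases h with h | ⟨q, hq, rfl, hj⟩
  · omega
  · refine Or.inr ⟨⟨i', i' + c', hi', by omega, by omega, by omega⟩, hF ?_ hq, rfl, rfl⟩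
    rw [TildeQ.le_def, hj]
    exact hle

theorem IsIdealPosition.lt (hpn : p < n) {i c : ℕ} (hi : 1 ≤ i) (h : IsIdealPosition F i c) :
    c < n := by
  rcases h with h | ⟨q, -, rfl, hj⟩
  · omega
  · have := q.lt
    omega

theorem exists_forall_isIdealPosition_iff_le (hpn : p < n) (hF : IsLowerSet (F : Set (TildeQ n p)))
    {i : ℕ} (hi : 1 ≤ i) (h0 : IsIdealPosition F i 0) :
    ∃ b : Fin n, ∀ c, IsIdealPosition F i c ↔ c ≤ b := by
  classical
  have hmax := Nat.findGreatest_spec (n := n - 1) (Nat.zero_le _) h0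
  refine ⟨⟨Nat.findGreatest (IsIdealPosition F i) (n - 1), hmax.lt hpn hi⟩, fun c => ?_⟩
  constructor
  · exact fun hc => Nat.le_findGreatest (Nat.le_pred_of_lt (hc.lt hpn hi)) hc
  · intro hc
    exact hmax.mono hF hi (hc.trans_lt (hmax.lt hpn hi)) (Or.inl ⟨le_rfl, Nat.add_le_add_left hc i⟩)

variable (F) in
theorem exists_isIdealPosition_and_not_succ :
    ∃ k, IsIdealPosition F (k + p) 0 ∧ ¬ IsIdealPosition F (k + p + 1) 0 := by
  classical
  have hex : ∃ k, ¬ IsIdealPosition F (k + p + 1) 0 := by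
    refine ⟨F.sup TildeQ.i, ?_⟩
    rintro (h | ⟨q, hq, hi, -⟩)
    · omega
    · have := Finset.le_sup (f := TildeQ.i) hq
      omega
  refine ⟨Nat.find hex, ?_, Nat.find_spec hex⟩
  rcases Nat.eq_zero_or_pos (Nat.find hex) with h | h
  · exact Or.inl (by omega)
  · have hmin := not_not.1 (Nat.find_min hex (Nat.pred_lt h.ne'))
    rwa [show (Nat.find hex).pred + p + 1 = Nat.find hex + p by
      rw [Nat.pred_eq_sub_one]; omega] at hmin

end IsIdealPosition

-- The number `k` is the last one for which `q_{k+p,k+p}` lies in `F`; the entries of `I` are then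
-- the lengths of the rows `k + 1, …, k + p` of `F`.
theorem exists_phi_eq (hpn : p < n) {F : Finset (TildeQ n p)}
    (hF : IsLowerSet (F : Set (TildeQ n p))) :
    ∃ I : Fin p → Fin n, StrictMono I ∧ ∃ k, phi I k = F := by
  obtain ⟨k, hk, hk_succ⟩ := exists_isIdealPosition_and_not_succ F
  have hrow : ∀ m : Fin p, ∃ b : Fin n, ∀ c, IsIdealPosition F (k + p - m) c ↔ c ≤ b := fun m =>
    exists_forall_isIdealPosition_iff_le hpn hF (by omega)
      (hk.mono hF (by omega) (by omega) (Or.inl (by omega)))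
  choose I hI using hrow
  refine ⟨I, fun m m' hmm' => ?_, k, ?_⟩
  · rw [Fin.lt_def] at hmm'
    have hm := (hI m _).2 le_rfl
    have hlt : (I m : ℕ) + 1 < n := by
      by_contra hn
      exact hk_succ (hm.mono hF (by omega) (by omega) (Or.inr (Or.inr (by omega))))
    exact (hI m' _).1 (hm.mono hF (by omega) hlt (Or.inl (by omega)))
  · ext q
    have hi := q.one_le
    have hij := q.le
    have hjn := q.lt
    rw [mem_phi, mem_iff_isIdealPosition]
    constructor
    · rintro (hq | ⟨m, hm, hq⟩)
      · exact hk.mono hF hi (by omega) (Or.inr (Or.inl (by omega)))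
      · rw [show q.i = k + p - m by omega, hI]
        omega
    · intro hq
      by_cases hqk : q.i ≤ k
      · exact Or.inl hqk
      have hqp : q.i ≤ k + p := by
        by_contra hqp
        exact hk_succ (hq.mono hF (by omega) (by omega) (Or.inl (by omega)))
      refine Or.inr ⟨⟨k + p - q.i, by omega⟩, by simp only; omega, ?_⟩
      rw [← tsub_le_iff_left, ← hI]
      rwa [show k + p - (k + p - q.i) = q.i by omega]

end Ideals

section PlueckerIndex

variable (n p : ℕ)

/-- The indices of the generators `D_I^{(k)}` with increasing `I`. -/
abbrev PlueckerIndex : Type := {I : Fin p → Fin n // StrictMono I} × ℕ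

namespace PlueckerIndex

variable {n p} (x : PlueckerIndex n p)

/-- The pair `(I, k)` itself, without the proof that `I` is increasing. -/
def toPair : (Fin p → Fin n) × ℕ := (x.1.1, x.2)

/-- The generator `D_I^{(k)}` with index `x = (I, k)`. -/
def generator : MvPolynomial (ZVar n p) ℂ := plueckerD x.1.1 x.2

/-- The order ideal `φ_ss(I^{(k)})` of the index `x = (I, k)`. -/
def ideal : Finset (TildeQ n p) := phi x.1.1 x.2

theorem isLowerSet_ideal (hpn : p < n) : IsLowerSet (x.ideal : Set (TildeQ n p)) :=
  isLowerSet_phi hpn x.1.2 x.2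

theorem exists_ideal_eq (hpn : p < n) {F : Finset (TildeQ n p)}
    (hF : IsLowerSet (F : Set (TildeQ n p))) : ∃ x : PlueckerIndex n p, x.ideal = F := by
  obtain ⟨I, hI, k, h⟩ := exists_phi_eq hpn hF
  exact ⟨(⟨I, hI⟩, k), h⟩

theorem ideal_injective (hp : 1 ≤ p) (hpn : p < n) :
    Function.Injective (ideal : PlueckerIndex n p → Finset (TildeQ n p)) := by
  rintro ⟨⟨I, hI⟩, a⟩ ⟨⟨J, hJ⟩, b⟩ (h : phi I a = phi J b)
  obtain rfl : a = b := le_antisymm (le_of_phi_subset_phi hp hpn h.subset)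
    (le_of_phi_subset_phi hp hpn h.symm.subset)
  obtain rfl : I = J := funext fun m => le_antisymm (apply_le_of_phi_subset_phi hJ h.subset m)
    (apply_le_of_phi_subset_phi hI h.symm.subset m)
  rfl

end PlueckerIndex

end PlueckerIndex

section Straightening

variable {ι A R : Type*} [CommSemiring R] [CommSemiring A] [Algebra R A] {f : ι → A} {w : ι → ℕ}
  {r : ι → ι → Prop}

theorem sum_sq_le_sq_sum (s : Multiset ℕ) : (s.map (· ^ 2)).sum ≤ s.sum ^ 2 := by
  induction s using Multiset.induction_on with
  | empty => rfl
  | cons a s ih =>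
    rw [Multiset.map_cons, Multiset.sum_cons, Multiset.sum_cons, add_sq]
    omega

theorem exists_multiset_map_prod_eq_of_mem_closure_range {M : Type*} [CommMonoid M] {g : ι → M}
    {a : M} (ha : a ∈ Submonoid.closure (Set.range g)) : ∃ s : Multiset ι, (s.map g).prod = a := by
  induction ha using Submonoid.closure_induction with
  | mem _ h =>
    obtain ⟨i, rfl⟩ := h
    exact ⟨{i}, by rw [Multiset.map_singleton, Multiset.prod_singleton]⟩
  | one => exact ⟨0, Multiset.prod_zero⟩
  | mul _ _ _ _ hs ht =>
    obtain ⟨s, rfl⟩ := hs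
    obtain ⟨t, rfl⟩ := ht
    exact ⟨s + t, by rw [Multiset.map_add, Multiset.prod_add]⟩

variable (R f r) in
/-- The span of the standard products: the products of those multisets of generators that are
chains for `r`. -/
def standardSpan : Submodule R A :=
  Submodule.span R (Set.range fun s : {s : Multiset ι // IsChain r {x | x ∈ s}} => (s.1.map f).prod)

theorem exists_eq_cons_cons_of_not_isChain {s : Multiset ι} (hs : ¬ IsChain r {x | x ∈ s}) :
    ∃ x y t, ¬ r x y ∧ w x ≤ w y ∧ s = x ::ₘ y ::ₘ t := by
  simp only [IsChain, Set.Pairwise, Set.mem_ofPred_eq, not_forall, not_or] at hs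
  obtain ⟨x, hx, y, hy, hne, hxy, hyx⟩ := hs
  obtain ⟨t, rfl⟩ := Multiset.exists_cons_of_mem hx
  obtain ⟨t, rfl⟩ := Multiset.exists_cons_of_mem ((Multiset.mem_cons.1 hy).resolve_left hne.symm)
  rcases le_total (w x) (w y) with h | h
  · exact ⟨x, y, t, hxy, h, rfl⟩
  · exact ⟨y, x, t, hyx, h, Multiset.cons_swap x y t⟩

theorem sq_add_sq_lt_sq_add_sq {a b c d : ℕ} (hab : a ≤ b) (hsum : c + d = a + b) (hc : c < a) :
    a ^ 2 + b ^ 2 < c ^ 2 + d ^ 2 := by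
  obtain ⟨e, rfl⟩ := Nat.exists_eq_add_of_lt hc
  obtain rfl : d = b + (e + 1) := by omega
  nlinarith

-- The sum of the squares of the weights grows at every rewriting, while the sum of the weights
-- stays constant.
theorem multiset_prod_mem_standardSpan
    (h : ∀ x y, ¬ r x y → w x ≤ w y → f x * f y ∈ spreadSpan R f w x y) (s : Multiset ι) :
    (s.map f).prod ∈ standardSpan R f r := by
  induction hN : (s.map w).sum ^ 2 - ((s.map w).map (· ^ 2)).sum using Nat.strong_induction_on
    generalizing s with
  | _ N ih =>
    by_cases hs : IsChain r {x | x ∈ s}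
    · exact Submodule.subset_span ⟨⟨s, hs⟩, rfl⟩
    obtain ⟨x, y, t, hxy, hw, rfl⟩ := exists_eq_cons_cons_of_not_isChain (w := w) hs
    rw [Multiset.map_cons, Multiset.map_cons, Multiset.prod_cons, Multiset.prod_cons, ← mul_assoc]
    suffices hle : spreadSpan R f w x y ≤
        (standardSpan R f r).comap (LinearMap.mulRight R (t.map f).prod) from hle (h x y hxy hw)
    refine Submodule.span_le.2 ?_
    rintro _ ⟨x', y', hsum, hlt, rfl⟩
    have hsq := sq_add_sq_lt_sq_add_sq hw hsum hlt
    have hbound := sum_sq_le_sq_sum ((x' ::ₘ y' ::ₘ t).map w)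
    have hmem := ih _ ?_ (x' ::ₘ y' ::ₘ t) rfl
    · simpa only [SetLike.mem_coe, Submodule.mem_comap, LinearMap.mulRight_apply,
        Multiset.map_cons, Multiset.prod_cons, ← mul_assoc] using hmem
    · simp only [Multiset.map_cons, Multiset.sum_cons, ← add_assoc, hsum] at hN hbound ⊢
      omega

theorem adjoin_range_le_standardSpan
    (h : ∀ x y, ¬ r x y → w x ≤ w y → f x * f y ∈ spreadSpan R f w x y) :
    Subalgebra.toSubmodule (Algebra.adjoin R (Set.range f)) ≤ standardSpan R f r := by
  rw [Algebra.adjoin_eq_span, Submodule.span_le]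
  intro g hg
  obtain ⟨s, rfl⟩ := exists_multiset_map_prod_eq_of_mem_closure_range hg
  exact multiset_prod_mem_standardSpan h s

end Straightening

section PlueckerStraightening

variable {n p : ℕ}

theorem plueckerD_eq_zero_of_not_injective {I : Fin p → Fin n} (hI : ¬ Function.Injective I)
    (k : ℕ) : plueckerD I k = 0 := by
  simp only [Function.Injective, not_forall] at hI
  obtain ⟨a, b, hab, hne⟩ := hI
  rw [plueckerD, Matrix.det_zero_of_column_eq hne fun i => ?_, map_zero]
  simp only [Matrix.submatrix_apply, hab]

theorem plueckerD_mem_span_generator (x : (Fin p → Fin n) × ℕ) :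
    plueckerD x.1 x.2 ∈ Submodule.span ℂ
      (PlueckerIndex.generator '' {y : PlueckerIndex n p | weight y.toPair = weight x}) := by
  obtain ⟨I, k⟩ := x
  by_cases hI : Function.Injective I
  · have hsort : StrictMono (I ∘ Tuple.sort I) :=
      (Tuple.monotone_sort I).strictMono_of_injective (hI.comp (Tuple.sort I).injective)
    have hperm := plueckerD_comp_perm (I ∘ Tuple.sort I) (Tuple.sort I)⁻¹ k
    rw [Function.comp_assoc, ← Equiv.Perm.coe_mul, mul_inv_cancel, Equiv.Perm.coe_one,
      Function.comp_id, ← zsmul_eq_mul] at hperm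
    rw [hperm]
    have hweight : weight (I ∘ Tuple.sort I, k) = weight (I, k) :=
      congrArg (_ + ·) (Equiv.sum_comp (Tuple.sort I) fun m => (I m : ℕ))
    refine zsmul_mem (Submodule.subset_span ?_) _
    exact ⟨(⟨_, hsort⟩, k), hweight, rfl⟩
  · simp only [plueckerD_eq_zero_of_not_injective hI, Submodule.zero_mem]

theorem spreadSpan_plueckerD_le (x y : PlueckerIndex n p) :
    spreadSpan ℂ (Function.uncurry plueckerD) weight x.toPair y.toPair ≤
      spreadSpan ℂ PlueckerIndex.generator (fun z => weight z.toPair) x y := by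
  refine Submodule.span_le.2 ?_
  rintro _ ⟨x', y', hsum, hlt, rfl⟩
  have hmem := Submodule.mul_mem_mul (plueckerD_mem_span_generator x')
    (plueckerD_mem_span_generator y')
  rw [Submodule.span_mul_span] at hmem
  refine Submodule.span_le.2 ?_ hmem
  rintro _ ⟨_, ⟨x'', hx, rfl⟩, _, ⟨y'', hy, rfl⟩, rfl⟩
  refine mul_mem_spreadSpan ?_ (Or.inl ?_)
  · simp only [hx.out, hy.out, hsum]
  · simp only [hx.out, hlt]

theorem generator_mul_generator_mem_spreadSpan {x y : PlueckerIndex n p}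
    (hxy : ¬ x.ideal ⊆ y.ideal) (hw : weight x.toPair ≤ weight y.toPair) :
    x.generator * y.generator ∈
      spreadSpan ℂ PlueckerIndex.generator (fun z => weight z.toPair) x y := by
  have hle : x.2 ≤ y.2 := le_of_not_gt fun hlt => hw.not_gt (weight_lt_of_lt hlt)
  obtain ⟨i, j, hij, hlt⟩ : ∃ i j : Fin p, (i : ℕ) + (y.2 - x.2) = j ∧ y.1.1 j < x.1.1 i := by
    by_contra! hIJ
    exact hxy (phi_subset_phi hle hIJ)
  exact spreadSpan_plueckerD_le x y (plueckerD_mul_plueckerD_mem_spreadSpan x.1.2 y.1.2 hij hlt)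

theorem plueckerAlgebra_eq_adjoin :
    plueckerAlgebra n p = Algebra.adjoin ℂ (Set.range (PlueckerIndex.generator (n := n))) := by
  refine le_antisymm (Algebra.adjoin_le ?_) (Algebra.adjoin_mono ?_)
  · rintro _ ⟨I, k, rfl⟩
    exact Algebra.span_le_adjoin _ _
      (Submodule.span_mono (Set.image_subset_range _ _) (plueckerD_mem_span_generator (I, k)))
  · rintro _ ⟨x, rfl⟩
    exact ⟨x.1.1, x.2, rfl⟩

theorem toSubmodule_plueckerAlgebra_eq_standardSpan :
    Subalgebra.toSubmodule (plueckerAlgebra n p) = standardSpan ℂ PlueckerIndex.generator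
      fun x y : PlueckerIndex n p => x.ideal ⊆ y.ideal := by
  rw [plueckerAlgebra_eq_adjoin]
  refine le_antisymm (adjoin_range_le_standardSpan fun _ _ =>
    generator_mul_generator_mem_spreadSpan) (Submodule.span_le.2 ?_)
  rintro _ ⟨t, rfl⟩
  refine Subalgebra.multiset_prod_mem _ fun g hg => ?_
  obtain ⟨x, -, rfl⟩ := Multiset.mem_map.1 hg
  exact Algebra.subset_adjoin ⟨x, rfl⟩

end PlueckerStraightening

section Scaling

variable {𝕜 : Type*} [Field 𝕜]

theorem exists_step_scaling {p : ℕ} (hp : 0 < p) {ε : ℕ → 𝕜} (hε : ∀ k, ε k ≠ 0) :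
    ∃ l : ℕ → 𝕜, (∀ r, l r ≠ 0) ∧ (∏ i ∈ Finset.range p, l i = ε 0) ∧
      ∀ r, l (r + p) = l r * (ε (r + 1) / ε r) := by
  refine ⟨fun r => (if r % p = 0 then ε 0 else 1) *
    ∏ j ∈ Finset.range (r / p), ε (r % p + j * p + 1) / ε (r % p + j * p), fun r => ?_, ?_,
    fun r => ?_⟩
  · refine mul_ne_zero ?_ (Finset.prod_ne_zero_iff.2 fun _ _ => div_ne_zero (hε _) (hε _))
    split_ifs
    exacts [hε 0, one_ne_zero]
  · rw [Finset.prod_eq_single_of_mem 0 (Finset.mem_range.2 hp)]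
    · simp only [Nat.zero_mod, Nat.zero_div, if_true, Finset.prod_range_zero, mul_one]
    · intro i hi hi0
      have hip := Finset.mem_range.1 hi
      simp only [Nat.mod_eq_of_lt hip, Nat.div_eq_of_lt hip, hi0, if_false,
        Finset.prod_range_zero, mul_one]
  · simp only [Nat.add_mod_right, Nat.add_div_right r hp,
      Finset.prod_range_succ, Nat.mod_add_div', mul_assoc]

theorem exists_scaling {p : ℕ} (hp : 0 < p) {ε : ℕ → 𝕜} (hε : ∀ k, ε k ≠ 0) :
    ∃ l : ℕ → 𝕜, (∀ r, l r ≠ 0) ∧ ∀ k, ∏ m : Fin p, l (k + m.rev) = ε k := by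
  obtain ⟨l, hl, hzero, hstep⟩ := exists_step_scaling hp hε
  refine ⟨l, hl, fun k => ?_⟩
  refine (Equiv.prod_comp Fin.revPerm fun m : Fin p => l (k + m)).trans ?_
  rw [Fin.prod_univ_eq_prod_range fun i => l (k + i)]
  induction k with
  | zero => simpa only [zero_add] using hzero
  | succ k ih =>
    have hshift := Finset.prod_range_succ (fun i => l (k + i)) p
    rw [Finset.prod_range_succ', ih, hstep, add_zero] at hshift
    refine mul_right_cancel₀ (hl k) ?_
    calc (∏ i ∈ Finset.range p, l (k + 1 + i)) * l k
        = (∏ i ∈ Finset.range p, l (k + (i + 1))) * l k := by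
          simp only [add_assoc, add_comm 1]
      _ = ε k * (l k * (ε (k + 1) / ε k)) := hshift
      _ = ε (k + 1) * l k := by field_simp [hε k]

end Scaling

section MonomialMap

variable {P : Type*}

/-- The monomial `s ^ d * y ^ u` of `ℂ[P][s]`. -/
def hibiTerm (d : ℕ) (u : P →₀ ℕ) : Polynomial (MvPolynomial P ℂ) :=
  Polynomial.monomial d (MvPolynomial.monomial u 1)

theorem hibiTerm_one (u : P →₀ ℕ) : hibiTerm 1 u = sMonomial u := by
  rw [hibiTerm, sMonomial, Polynomial.X_mul_C, Polynomial.C_mul_X_eq_monomial]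

theorem multiset_prod_hibiTerm {ι : Type*} (s : Multiset ι) (d : ι → ℕ) (u : ι → P →₀ ℕ) :
    (s.map fun i => hibiTerm (d i) (u i)).prod = hibiTerm (s.map d).sum (s.map u).sum := by
  induction s using Multiset.induction_on with
  | empty => rfl
  | cons i s ih =>
    rw [Multiset.map_cons, Multiset.prod_cons, ih]
    simp only [Multiset.map_cons, Multiset.sum_cons, hibiTerm,
      Polynomial.monomial_mul_monomial, MvPolynomial.monomial_mul, one_mul]

theorem linearIndependent_hibiTerm :
    LinearIndependent ℂ fun x : ℕ × (P →₀ ℕ) => hibiTerm x.1 x.2 := by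
  have h := ((MvPolynomial.basisMonomials P ℂ).smulTower
    (Polynomial.basisMonomials (MvPolynomial P ℂ))).linearIndependent
  refine (linearIndependent_equiv' (Equiv.prodComm _ _) ?_).1 h
  ext1 x
  simp [hibiTerm, Module.Basis.smulTower_apply, Polynomial.smul_monomial]

variable {n p : ℕ}

theorem finite_setOf_i_le (N : ℕ) : {q : TildeQ n p | q.i ≤ N}.Finite := by
  refine Set.Finite.of_finite_image (f := fun q : TildeQ n p => (q.i, q.j)) ?_ fun a _ b _ hab =>
    TildeQ.ext (congrArg Prod.fst hab) (congrArg Prod.snd hab)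
  refine (Set.finite_Iic ((N, N + n) : ℕ × ℕ)).subset ?_
  rintro _ ⟨q, hq, rfl⟩
  exact ⟨hq, q.lt.le.trans (Nat.add_le_add_right hq n)⟩

/-- The set of those `q` whose `y_q` divides the image of the variable in row `r` and column `c`
under the isomorphism with the Hibi ring. The rows `k, …, k + p - 1` of the initial term of
`D_I^{(k)}` represent each residue class modulo `p` once, and the row congruent to `i - 1`
decides whether `q_{i,j}` occurs in its image. -/
def varSupport (n p r c : ℕ) : Finset (TildeQ n p) :=
  ((finite_setOf_i_le (r + 1)).subset (t := {q : TildeQ n p |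
    q.i - 1 ≡ r [MOD p] ∧ (q.i ≤ r ∨ q.i = r + 1 ∧ q.j ≤ q.i + c)}) fun _ h =>
      h.2.elim Nat.le_succ_of_le fun h => h.1.le).toFinset

theorem mem_varSupport {r c : ℕ} {q : TildeQ n p} : q ∈ varSupport n p r c ↔
    q.i - 1 ≡ r [MOD p] ∧ (q.i ≤ r ∨ q.i = r + 1 ∧ q.j ≤ q.i + c) := by
  rw [varSupport, Set.Finite.mem_toFinset, Set.mem_ofPred_eq]

/-- The row of a variable in the stacked matrix, as in `rowVar`. -/
def varRow (v : ZVar n p) : ℕ := p * (ofLex v).1 + (ofLex (ofLex v).2).1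

/-- The column of a variable. -/
def varCol (v : ZVar n p) : Fin n := (ofLex (ofLex v).2).2

/-- The homomorphism that restricts to the isomorphism with the Hibi ring. The initial term of each
`D_I^{(k)}` has exactly one variable in a row divisible by `p`, which accounts for the factor `s`;
the scalars `l` correct the signs of the initial terms. -/
def termHom (l : ℕ → ℂ) :
    MvPolynomial (ZVar n p) ℂ →ₐ[ℂ] Polynomial (MvPolynomial (TildeQ n p) ℂ) :=
  MvPolynomial.aeval fun v => l (varRow v) • hibiTerm (if varRow v % p = 0 then 1 else 0)
    (idealPoint Set.univ ∅ (varSupport n p (varRow v) (varCol v)))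

variable [NeZero p]

theorem termHom_X_rowVar (l : ℕ → ℂ) (r : ℕ) (c : Fin n) :
    termHom l (MvPolynomial.X (rowVar r c : ZVar n p)) =
      l r • hibiTerm (if r % p = 0 then 1 else 0) (idealPoint Set.univ ∅ (varSupport n p r c)) := by
  have hrow : varRow (rowVar r c : ZVar n p) = r := Nat.div_add_mod r p
  rw [termHom, MvPolynomial.aeval_X, hrow]
  rfl

theorem exists_modEq_sum_eq {M : Type*} [AddCommMonoid M] (k r : ℕ) (F : Fin p → M)
    (hF : ∀ m : Fin p, ¬ r ≡ k + m.rev [MOD p] → F m = 0) :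
    ∃ m : Fin p, r ≡ k + m.rev [MOD p] ∧ ∑ m, F m = F m := by
  refine ⟨(initPerm p k).symm (Fin.ofNat p r), ?_, ?_⟩
  · rw [Nat.ModEq, ← val_initPerm, Equiv.apply_symm_apply]
    rfl
  · refine Finset.sum_eq_single_of_mem _ (Finset.mem_univ _) fun m _ hm => hF m fun hr => hm ?_
    rw [Equiv.eq_symm_apply]
    exact Fin.ext ((val_initPerm k m).trans hr.symm)

theorem sum_ite_add_rev_mod_eq_zero (k : ℕ) :
    ∑ m : Fin p, (if (k + (m.rev : ℕ)) % p = 0 then 1 else 0) = 1 := by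
  obtain ⟨m, hm, hsum⟩ := exists_modEq_sum_eq (p := p) k 0
    (fun m => if (k + (m.rev : ℕ)) % p = 0 then 1 else 0) fun m hm => if_neg fun h => hm (by
      rw [Nat.ModEq, h, Nat.zero_mod])
  rw [hsum, if_pos (Eq.trans hm.symm (Nat.zero_mod p))]

theorem mem_varSupport_iff_mem_phi {I : Fin p → Fin n} {k : ℕ} {m : Fin p} {q : TildeQ n p}
    (hm : q.i - 1 ≡ k + m.rev [MOD p]) : q ∈ varSupport n p (k + m.rev) (I m) ↔ q ∈ phi I k := by
  have hi := q.one_le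
  have hrev := Fin.val_rev m
  rw [mem_varSupport, mem_phi]
  constructor
  · rintro ⟨-, hq | ⟨hq, hj⟩⟩
    · have := hm.add_le_of_lt (by omega)
      exact Or.inl (by omega)
    · exact Or.inr ⟨m, by omega, hj⟩
  · refine fun h => ⟨hm, ?_⟩
    rcases h with hq | ⟨m', hm', hj⟩
    · exact Or.inl (hq.trans (Nat.le_add_right _ _))
    · obtain rfl : m' = m := by
        refine (initPerm p k).injective (Fin.ext ?_)
        rw [val_initPerm, val_initPerm, ← hm, Fin.val_rev]
        congr 1
        omega
      exact Or.inr ⟨by omega, hj⟩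

theorem sum_idealPoint_varSupport (I : Fin p → Fin n) (k : ℕ) :
    ∑ m : Fin p, idealPoint Set.univ ∅ (varSupport n p (k + m.rev) (I m)) =
      idealPoint Set.univ ∅ (phi I k) := by
  classical
  ext q
  simp only [Finsupp.finsetSum_apply, idealPoint_univ_apply]
  obtain ⟨m, hm, hsum⟩ := exists_modEq_sum_eq (p := p) k (q.i - 1)
    (fun m => if q ∈ varSupport n p (k + m.rev) (I m) then 1 else 0) fun m hm => if_neg fun h => hm
      (mem_varSupport.1 h).1
  rw [hsum]
  exact if_congr (mem_varSupport_iff_mem_phi hm) rfl rfl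

theorem termHom_monomial_initExp (l : ℕ → ℂ) (I : Fin p → Fin n) (k : ℕ) :
    termHom l (MvPolynomial.monomial (initExp I k) 1) =
      (∏ m : Fin p, l (k + m.rev)) • sMonomial (idealPoint Set.univ ∅ (phi I k)) := by
  have hprod : ∏ m : Fin p, hibiTerm (if (k + (m.rev : ℕ)) % p = 0 then 1 else 0)
      (idealPoint Set.univ ∅ (varSupport n p (k + m.rev) (I m))) =
      sMonomial (idealPoint Set.univ ∅ (phi I k)) := by
    refine (multiset_prod_hibiTerm _ _ _).trans ?_
    rw [← hibiTerm_one]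
    exact congrArg₂ hibiTerm (sum_ite_add_rev_mod_eq_zero k) (sum_idealPoint_varSupport I k)
  rw [initExp, rowExp, MvPolynomial.monomial_sum_one, map_prod, ← hprod, ← Finset.prod_smul]
  exact Finset.prod_congr rfl fun m _ => termHom_X_rowVar l _ _

end MonomialMap

section Gradings

variable {ι R A B S : Type*} [CommRing R] [CommRing A] [Algebra R A] [CommRing B] [Algebra R B]
  [CommRing S] [Algebra R S]

theorem iSupIndep_comap {M N : Type*} [AddCommGroup M] [Module R M] [AddCommGroup N] [Module R N]
    {f : M →ₗ[R] N} (hf : Function.Injective f) {p : ι → Submodule R N} (hp : iSupIndep p) :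
    iSupIndep fun i => (p i).comap f := by
  refine fun i => Submodule.disjoint_def.2 fun x hx hx' => hf ?_
  have hle : (⨆ (j) (_ : j ≠ i), (p j).comap f).map f ≤ ⨆ (j) (_ : j ≠ i), p j := by
    simp only [Submodule.map_iSup]
    exact iSup₂_mono fun j _ => Submodule.map_comap_le _ _
  rw [map_zero]
  exact Submodule.disjoint_def.1 (hp i) _ hx (hle (Submodule.mem_map_of_mem hx'))

variable [AddMonoid ι]

theorem gradedMonoid_comap (f : S →ₐ[R] A) (𝒜 : ι → Submodule R A) [SetLike.GradedMonoid 𝒜] :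
    SetLike.GradedMonoid fun i => (𝒜 i).comap f.toLinearMap where
  one_mem := by
    rw [Submodule.mem_comap, AlgHom.toLinearMap_apply, map_one]
    exact SetLike.one_mem_graded 𝒜
  mul_mem i j x y hx hy := by
    rw [Submodule.mem_comap, AlgHom.toLinearMap_apply, map_mul]
    exact SetLike.mul_mem_graded hx hy

theorem iSup_eq_top_of_adjoin_eq_top {𝒜 : ι → Submodule R A} [SetLike.GradedMonoid 𝒜] {G : Set A}
    (hG : Algebra.adjoin R G = ⊤) (h : ∀ g ∈ G, ∃ i, g ∈ 𝒜 i) : iSup 𝒜 = ⊤ := by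
  classical
  rw [Submodule.iSup_eq_toSubmodule_range, eq_top_iff, ← Algebra.top_toSubmodule, ← hG]
  refine Algebra.adjoin_le fun g hg => ?_
  obtain ⟨i, hi⟩ := h g hg
  exact ⟨DirectSum.of (fun i => 𝒜 i) i ⟨g, hi⟩, DirectSum.coeAlgHom_of 𝒜 i ⟨g, hi⟩⟩

variable {𝒜 : ι → Submodule R A} [SetLike.GradedMonoid 𝒜] {f : S →ₐ[R] A}
  (hf : Function.Injective f) (h𝒜 : iSupIndep 𝒜)
include hf h𝒜

theorem nonempty_gradedAlgebra_comap [DecidableEq ι] {G : Set S}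
    (hG : Algebra.adjoin R G = ⊤) (h : ∀ g ∈ G, ∃ i, f g ∈ 𝒜 i) :
    Nonempty (GradedAlgebra fun i => (𝒜 i).comap f.toLinearMap) := by
  have := gradedMonoid_comap f 𝒜
  exact ⟨{ (DirectSum.isInternal_submodule_of_iSupIndep_of_iSup_eq_top (iSupIndep_comap hf h𝒜)
    (iSup_eq_top_of_adjoin_eq_top (𝒜 := fun i => (𝒜 i).comap f.toLinearMap) hG
      h)).chooseDecomposition, this with }⟩

theorem comap_eq_comap_of_adjoin_eq_top {ℬ : ι → Submodule R B} [SetLike.GradedMonoid ℬ]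
    (hℬ : iSupIndep ℬ) {g : S →ₐ[R] B} (hg : Function.Injective g) {G : Set S}
    (hG : Algebra.adjoin R G = ⊤) (h : ∀ x ∈ G, ∃ i, f x ∈ 𝒜 i ∧ g x ∈ ℬ i) (i : ι) :
    (𝒜 i).comap f.toLinearMap = (ℬ i).comap g.toLinearMap := by
  have h₁ := gradedMonoid_comap f 𝒜
  have h₂ := gradedMonoid_comap g ℬ
  have : SetLike.GradedMonoid fun i =>
      (𝒜 i).comap f.toLinearMap ⊓ (ℬ i).comap g.toLinearMap :=
    { one_mem := ⟨h₁.one_mem, h₂.one_mem⟩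
      mul_mem := fun _ _ _ _ hx hy => ⟨h₁.mul_mem hx.1 hy.1, h₂.mul_mem hx.2 hy.2⟩ }
  have htop : ⨆ i, (𝒜 i).comap f.toLinearMap ⊓ (ℬ i).comap g.toLinearMap = ⊤ :=
    iSup_eq_top_of_adjoin_eq_top hG h
  have hinf𝒜 := ((iSupIndep_comap hf h𝒜).le_iff_eq_of_iSup_eq_top htop).1 fun _ => inf_le_left
  have hinfℬ := ((iSupIndep_comap hg hℬ).le_iff_eq_of_iSup_eq_top htop).1 fun _ => inf_le_right
  exact congrFun (hinf𝒜.symm.trans hinfℬ) i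

omit hf in
theorem nonempty_gradedAlgebra_comap_val [DecidableEq ι] {T : Subalgebra R A} {G : Set A}
    (hT : Algebra.adjoin R G = T) (h : ∀ g ∈ G, ∃ i, g ∈ 𝒜 i) :
    Nonempty (GradedAlgebra fun i => (𝒜 i).comap T.val.toLinearMap) := by
  have hG : Algebra.adjoin R ((↑) ⁻¹' G : Set T) = ⊤ := by
    subst hT
    exact Algebra.adjoin_adjoin_coe_preimage
  exact nonempty_gradedAlgebra_comap (f := T.val) Subtype.val_injective h𝒜 hG fun x hx => h x hx

end Gradings

section SGrading

variable {P : Type*}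

variable (P) in
/-- The component of degree `d` of `ℂ[P][s]`, for the grading by degree in `s`. -/
def sGrade (d : ℕ) : Submodule ℂ (Polynomial (MvPolynomial P ℂ)) :=
  LinearMap.range ((Polynomial.monomial (R := MvPolynomial P ℂ) d).restrictScalars ℂ)

instance gradedMonoid_sGrade : SetLike.GradedMonoid (sGrade P) where
  one_mem := ⟨1, rfl⟩
  mul_mem := by
    rintro d e _ _ ⟨a, rfl⟩ ⟨b, rfl⟩
    exact ⟨a * b, (Polynomial.monomial_mul_monomial d e a b).symm⟩

variable (P) in
theorem iSupIndep_sGrade : iSupIndep (sGrade P) := by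
  refine fun d => Submodule.disjoint_def.2 ?_
  rintro _ ⟨c, rfl⟩ h
  have hle : ⨆ (j) (_ : j ≠ d), sGrade P j ≤
      LinearMap.ker ((Polynomial.lcoeff (MvPolynomial P ℂ) d).restrictScalars ℂ) := by
    refine iSup₂_le fun j hj => ?_
    rintro _ ⟨c, rfl⟩
    simp [Polynomial.coeff_monomial, hj]
  have hc : c = 0 := by simpa using hle h
  rw [hc, map_zero]

theorem sMonomial_mem_sGrade (u : P →₀ ℕ) : sMonomial u ∈ sGrade P 1 :=
  ⟨MvPolynomial.monomial u 1, hibiTerm_one u⟩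

variable [LE P] {O C : Set P}

theorem sMonomial_mem_hibiRing {J : Finset P} (hJ : IsLowerSet (J : Set P)) :
    sMonomial (idealPoint O C J) ∈ hibiRing P O C :=
  Algebra.subset_adjoin ⟨J, hJ, rfl⟩

variable (P O C) in
theorem nonempty_gradedAlgebra_hibiGrade : Nonempty (GradedAlgebra (hibiGrade P O C)) := by
  refine nonempty_gradedAlgebra_comap_val (𝒜 := sGrade P) (iSupIndep_sGrade P) rfl ?_
  rintro _ ⟨J, -, rfl⟩
  exact ⟨1, sMonomial_mem_sGrade _⟩

end SGrading

theorem monomial_multiset_sum {σ ι R : Type*} [CommSemiring R] (s : Multiset ι)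
    (e : ι → σ →₀ ℕ) : MvPolynomial.monomial (s.map e).sum (1 : R) =
      (s.map fun i => MvPolynomial.monomial (e i) 1).prod := by
  induction s using Multiset.induction_on with
  | empty => rfl
  | cons i s ih =>
    simp only [Multiset.map_cons, Multiset.sum_cons, Multiset.prod_cons, ← ih,
      MvPolynomial.monomial_mul, one_mul]

section StandardMultisets

variable {n p : ℕ}

variable (n p) in
/-- The finite multisets of generators whose order ideals form a chain, the semi-infinite analogue
of semistandard Young tableaux. They index bases of the Plücker algebra, of its initial
subalgebra and of the Hibi ring. -/
abbrev StandardMultiset : Type :=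
  {t : Multiset (PlueckerIndex n p) // IsChain (fun x y => x.ideal ⊆ y.ideal) {x | x ∈ t}}

/-- The exponents of `s` and of the `y_q` in the monomial of the Hibi ring indexed by `t`. -/
def StandardMultiset.hibiExponent (t : StandardMultiset n p) : ℕ × (TildeQ n p →₀ ℕ) :=
  (t.1.card, (t.1.map fun x => idealPoint Set.univ ∅ x.ideal).sum)

theorem StandardMultiset.hibiExponent_injective (hp : 1 ≤ p) (hpn : p < n) :
    Function.Injective (hibiExponent : StandardMultiset n p → ℕ × (TildeQ n p →₀ ℕ)) :=
  fun s t h => Subtype.ext (eq_of_sum_idealPoint_eq (PlueckerIndex.ideal_injective hp hpn) s.2 t.2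
    (congrArg Prod.fst h) (congrArg Prod.snd h))

variable [NeZero p]

/-- The exponent of the initial monomial of `D_I^{(k)}`, where `x = (I, k)`. -/
def PlueckerIndex.exponent (x : PlueckerIndex n p) : ZVar n p →₀ ℕ := initExp x.1.1 x.2

theorem PlueckerIndex.coe_initialD (x : PlueckerIndex n p) :
    (initialD x.1.1 x.2 : MvPolynomial (ZVar n p) ℂ) =
      initSign p x.2 • MvPolynomial.monomial x.exponent 1 := by
  rw [SemiInfinite.coe_initialD x.1.2, MvPolynomial.smul_monomial, smul_eq_mul, mul_one]
  rfl

theorem PlueckerIndex.isLeading_generator (x : PlueckerIndex n p) :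
    IsLeading degRevLexKey x.generator x.exponent :=
  isLeading_plueckerD x.1.2 x.2

/-- The exponent of the initial monomial of the standard product indexed by `t`. -/
def StandardMultiset.exponent (t : StandardMultiset n p) : ZVar n p →₀ ℕ :=
  (t.1.map PlueckerIndex.exponent).sum

variable {l : ℕ → ℂ}

theorem termHom_monomial_exponent (l : ℕ → ℂ) (t : StandardMultiset n p) :
    termHom l (MvPolynomial.monomial t.exponent 1) =
      (t.1.map fun x => ∏ m : Fin p, l (x.2 + m.rev)).prod •
        hibiTerm t.hibiExponent.1 t.hibiExponent.2 := by
  have hterm : ∀ x : PlueckerIndex n p, termHom l (MvPolynomial.monomial x.exponent 1) =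
      (∏ m : Fin p, l (x.2 + m.rev)) • hibiTerm 1 (idealPoint Set.univ ∅ x.ideal) := fun x => by
    rw [hibiTerm_one]
    exact termHom_monomial_initExp l x.1.1 x.2
  have hcard : t.1.card = (t.1.map fun _ => 1).sum := by simp
  rw [StandardMultiset.exponent, monomial_multiset_sum, map_multiset_prod, Multiset.map_map,
    StandardMultiset.hibiExponent, hcard, ← multiset_prod_hibiTerm]
  induction t.1 using Multiset.induction_on with
  | empty => simp
  | cons x s ih =>
    simp only [Multiset.map_cons, Multiset.prod_cons, ih]
    rw [Function.comp_apply, hterm, smul_mul_smul_comm]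

theorem linearIndependent_termHom_monomial (hpn : p < n) (hl : ∀ r, l r ≠ 0) :
    LinearIndependent ℂ ((termHom l).toLinearMap ∘ fun t : StandardMultiset n p =>
      MvPolynomial.monomial t.exponent 1) := by
  have hne : ∀ t : StandardMultiset n p,
      (t.1.map fun x => ∏ m : Fin p, l (x.2 + m.rev)).prod ≠ 0 := fun t => by
    simp only [ne_eq, Multiset.prod_eq_zero_iff, Multiset.mem_map, not_exists, not_and]
    exact fun x _ => Finset.prod_ne_zero_iff.2 fun m _ => hl _
  have h := (linearIndependent_hibiTerm.comp _
    (StandardMultiset.hibiExponent_injective NeZero.one_le hpn)).units_smul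
      fun t : StandardMultiset n p => Units.mk0 _ (hne t)
  convert h using 1
  exact funext fun t => termHom_monomial_exponent l t

theorem StandardMultiset.exponent_injective (hpn : p < n) :
    Function.Injective (exponent : StandardMultiset n p → ZVar n p →₀ ℕ) := by
  have h := (linearIndependent_termHom_monomial (n := n) (p := p) (l := 1) hpn
    fun _ => one_ne_zero).injective
  exact fun s t hst => h (by simp only [Function.comp_apply, hst])

end StandardMultisets

section InitialPluecker

variable {n p : ℕ} [NeZero p]

theorem toSubmodule_initialPluecker_eq_span (hpn : p < n) :
    Subalgebra.toSubmodule (initialPluecker n p) = Submodule.span ℂ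
      (Set.range fun t : StandardMultiset n p => MvPolynomial.monomial t.exponent 1) := by
  have hlead : ∀ t : StandardMultiset n p,
      IsLeading degRevLexKey (t.1.map PlueckerIndex.generator).prod t.exponent := fun t =>
    IsLeading.multiset_prod PlueckerIndex.isLeading_generator t.1
  have hinj := degRevLexKey_injective.comp (StandardMultiset.exponent_injective (p := p) hpn)
  exact toSubmodule_initialSubalgebra_eq_span degRevLexLT_iff
    toSubmodule_plueckerAlgebra_eq_standardSpan hlead hinj

theorem adjoin_range_initialD_eq_top (hpn : p < n) : Algebra.adjoin ℂ
    (Set.range fun x : PlueckerIndex n p => initialD x.1.1 x.2) = ⊤ := by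
  refine Subalgebra.map_injective (f := (initialPluecker n p).val)
    Subtype.val_injective ?_
  have hmem : ∀ x : PlueckerIndex n p, MvPolynomial.monomial x.exponent 1 ∈
      (Algebra.adjoin ℂ (Set.range fun x : PlueckerIndex n p => initialD x.1.1 x.2)).map
        (initialPluecker n p).val := fun x => by
    have hx := map_smul (initialPluecker n p).val (initSign p x.2)⁻¹ (initialD x.1.1 x.2)
    rw [Subalgebra.coe_val, x.coe_initialD, inv_smul_smul₀ (initSign_ne_zero _)] at hx
    exact ⟨_, Subalgebra.smul_mem _ (Algebra.subset_adjoin (Set.mem_range_self x)) _, hx⟩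
  refine le_antisymm (Subalgebra.map_mono le_top) ?_
  rw [Algebra.map_top, Subalgebra.range_val, ← Subalgebra.toSubmodule.le_iff_le,
    toSubmodule_initialPluecker_eq_span hpn, Submodule.span_le]
  rintro _ ⟨t, rfl⟩
  simp only [StandardMultiset.exponent, monomial_multiset_sum]
  exact Subalgebra.multiset_prod_mem _ (Multiset.forall_mem_map_iff.2 fun x _ => hmem x)

theorem initialD_mem_initialGrade_one (x : PlueckerIndex n p) :
    initialD x.1.1 x.2 ∈ initialGrade n p 1 := by
  change (initialD x.1.1 x.2 : MvPolynomial (ZVar n p) ℂ).IsHomogeneous (p * 1)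
  rw [coe_initialD x.1.2, mul_one]
  exact MvPolynomial.isHomogeneous_monomial _ (degree_rowExp _ _)

omit [NeZero p] in
variable (n p) in
theorem gradedMonoid_homogeneousSubmodule_mul : SetLike.GradedMonoid fun d =>
    MvPolynomial.homogeneousSubmodule (ZVar n p) ℂ (p * d) where
  one_mem := MvPolynomial.isHomogeneous_one _ _
  mul_mem d e f g hf hg := by
    have h := MvPolynomial.IsHomogeneous.mul hf hg
    rw [← mul_add] at h
    exact h

variable (n p) in
theorem iSupIndep_homogeneousSubmodule_mul : iSupIndep fun d =>
    MvPolynomial.homogeneousSubmodule (ZVar n p) ℂ (p * d) := by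
  have := MvPolynomial.gradedAlgebra (σ := ZVar n p) (R := ℂ)
  exact (DirectSum.Decomposition.isInternal
    (MvPolynomial.homogeneousSubmodule (ZVar n p) ℂ)).submodule_iSupIndep.comp
      (mul_right_injective₀ (NeZero.ne p))

theorem nonempty_gradedAlgebra_initialGrade (hpn : p < n) :
    Nonempty (GradedAlgebra (initialGrade n p)) := by
  have := gradedMonoid_homogeneousSubmodule_mul n p
  refine nonempty_gradedAlgebra_comap (f := (initialPluecker n p).val) Subtype.val_injective
    (iSupIndep_homogeneousSubmodule_mul n p) (adjoin_range_initialD_eq_top hpn) ?_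
  rintro _ ⟨x, rfl⟩
  exact ⟨1, initialD_mem_initialGrade_one x⟩

end InitialPluecker

section Isomorphism

variable {n p : ℕ} [NeZero p] {l : ℕ → ℂ}

/-- The restriction of `termHom` to the initial subalgebra. -/
def initialTermHom (l : ℕ → ℂ) :
    initialPluecker n p →ₐ[ℂ] Polynomial (MvPolynomial (TildeQ n p) ℂ) :=
  (termHom l).comp (initialPluecker n p).val

theorem initialTermHom_initialD (l : ℕ → ℂ) {I : Fin p → Fin n} (hI : StrictMono I) (k : ℕ) :
    initialTermHom l (initialD I k) = (initSign p k * ∏ m : Fin p, l (k + m.rev)) •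
      sMonomial (idealPoint Set.univ ∅ (phi I k)) := by
  change termHom l (initialD I k : MvPolynomial (ZVar n p) ℂ) = _
  rw [PlueckerIndex.coe_initialD (⟨I, hI⟩, k), map_smul, mul_smul]
  exact congrArg _ (termHom_monomial_initExp l I k)

theorem initialTermHom_injective (hpn : p < n) (hl : ∀ r, l r ≠ 0) :
    Function.Injective (initialTermHom (n := n) (p := p) l) := by
  have hdisj := Submodule.range_ker_disjoint (linearIndependent_termHom_monomial hpn hl)
  rw [← toSubmodule_initialPluecker_eq_span hpn] at hdisj
  refine (injective_iff_map_eq_zero _).2 fun f hf => Subtype.ext ?_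
  exact Submodule.disjoint_def.1 hdisj _ f.2 hf

theorem range_initialTermHom (hpn : p < n) (hl : ∀ r, l r ≠ 0) :
    (initialTermHom (n := n) (p := p) l).range = hibiRing (TildeQ n p) Set.univ ∅ := by
  have hc : ∀ k, initSign p k * ∏ m : Fin p, l (k + m.rev) ≠ 0 := fun k =>
    mul_ne_zero (initSign_ne_zero k) (Finset.prod_ne_zero_iff.2 fun m _ => hl _)
  refine le_antisymm ?_ (Algebra.adjoin_le ?_)
  · rw [← Algebra.map_top, ← adjoin_range_initialD_eq_top hpn, AlgHom.map_adjoin,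
      Algebra.adjoin_le_iff]
    rintro _ ⟨_, ⟨x, rfl⟩, rfl⟩
    rw [initialTermHom_initialD l x.1.2]
    exact Subalgebra.smul_mem _ (sMonomial_mem_hibiRing (x.isLowerSet_ideal hpn)) _
  · rintro _ ⟨J, hJ, rfl⟩
    obtain ⟨x, rfl⟩ := PlueckerIndex.exists_ideal_eq hpn hJ
    refine ⟨(initSign p x.2 * ∏ m : Fin p, l (x.2 + m.rev))⁻¹ • initialD x.1.1 x.2, ?_⟩
    change initialTermHom l _ = _
    rw [map_smul, initialTermHom_initialD l x.1.2]
    exact inv_smul_smul₀ (hc x.2) _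

/-- The isomorphism of the initial subalgebra with the Hibi ring, depending on scalars `l` that
are to be chosen to produce the right signs. -/
def initialEquivHibi (hpn : p < n) (hl : ∀ r, l r ≠ 0) :
    initialPluecker n p ≃ₐ[ℂ] hibiRing (TildeQ n p) Set.univ ∅ :=
  (AlgEquiv.ofInjective _ (initialTermHom_injective hpn hl)).trans
    (Subalgebra.equivOfEq _ _ (range_initialTermHom hpn hl))

theorem coe_initialEquivHibi_initialD (hpn : p < n) (hl : ∀ r, l r ≠ 0) {I : Fin p → Fin n}
    (hI : StrictMono I) (k : ℕ) :
    (initialEquivHibi hpn hl (initialD I k) : Polynomial (MvPolynomial (TildeQ n p) ℂ)) =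
      (initSign p k * ∏ m : Fin p, l (k + m.rev)) •
        sMonomial (idealPoint Set.univ ∅ (phi I k)) :=
  initialTermHom_initialD l hI k

theorem mem_initialGrade_iff (hpn : p < n) (hl : ∀ r, l r ≠ 0) (d : ℕ) (x : initialPluecker n p) :
    x ∈ initialGrade n p d ↔
      initialEquivHibi hpn hl x ∈ hibiGrade (TildeQ n p) Set.univ ∅ d := by
  have := gradedMonoid_homogeneousSubmodule_mul n p
  refine SetLike.ext_iff.1 (comap_eq_comap_of_adjoin_eq_top (f := (initialPluecker n p).val)
    Subtype.val_injective (iSupIndep_homogeneousSubmodule_mul n p) (iSupIndep_sGrade _)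
    (initialTermHom_injective hpn hl) (adjoin_range_initialD_eq_top hpn) ?_ d) x
  rintro _ ⟨x, rfl⟩
  refine ⟨1, initialD_mem_initialGrade_one x, ?_⟩
  rw [initialTermHom_initialD l x.1.2]
  exact Submodule.smul_mem _ _ (sMonomial_mem_sGrade _)

theorem initialPluecker_algHom_ext (hpn : p < n) {B : Type*} [Semiring B] [Algebra ℂ B]
    {Ψ Φ : initialPluecker n p →ₐ[ℂ] B}
    (h : ∀ I : Fin p → Fin n, StrictMono I → ∀ k, Ψ (initialD I k) = Φ (initialD I k)) :
    Ψ = Φ := by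
  refine AlgHom.ext_of_adjoin_eq_top (adjoin_range_initialD_eq_top hpn) ?_
  rintro _ ⟨x, rfl⟩
  exact h x.1.1 x.1.2 x.2

end Isomorphism

end SemiInfinite

end

theorem lemma3 (n p : ℕ) (hp : 1 ≤ p) (hpn : p < n) :
    -- both algebras are graded by `ℕ`
    Nonempty (GradedAlgebra (SemiInfinite.initialGrade n p)) ∧
    Nonempty (GradedAlgebra
      (SemiInfinite.hibiGrade (SemiInfinite.TildeQ n p) Set.univ ∅)) ∧
    ∃ Φ : SemiInfinite.initialPluecker n p ≃ₐ[ℂ]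
        SemiInfinite.hibiRing (SemiInfinite.TildeQ n p) Set.univ ∅,
      -- `Φ` is compatible with the gradings
      (∀ (d : ℕ) (x : SemiInfinite.initialPluecker n p),
        x ∈ SemiInfinite.initialGrade n p d ↔
          Φ x ∈ SemiInfinite.hibiGrade (SemiInfinite.TildeQ n p) Set.univ ∅ d) ∧
      -- `Φ` is given by the formula on the initial terms of the `D_I^{(k)}`
      (∀ I : Fin p → Fin n, StrictMono I → ∀ k : ℕ,
        (Φ (SemiInfinite.initialD I k) : Polynomial (MvPolynomial (SemiInfinite.TildeQ n p) ℂ)) =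
          (-1) ^ (n.choose 2 + (k % p) * (n - 1)) *
            SemiInfinite.sMonomial
              (SemiInfinite.idealPoint Set.univ ∅ (SemiInfinite.phi I k))) ∧
      -- and is determined by it
      (∀ Ψ : SemiInfinite.initialPluecker n p ≃ₐ[ℂ]
          SemiInfinite.hibiRing (SemiInfinite.TildeQ n p) Set.univ ∅,
        (∀ I : Fin p → Fin n, StrictMono I → ∀ k : ℕ,
          Ψ (SemiInfinite.initialD I k) = Φ (SemiInfinite.initialD I k)) → Ψ = Φ) := by
  have : NeZero p := ⟨by omega⟩
  obtain ⟨l, hl, hprod⟩ := SemiInfinite.exists_scaling hp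
    (ε := fun k => (-1) ^ (n.choose 2 + (k % p) * (n - 1)) / SemiInfinite.initSign p k)
    fun k => div_ne_zero (pow_ne_zero _ (neg_ne_zero.2 one_ne_zero))
      (SemiInfinite.initSign_ne_zero k)
  refine ⟨SemiInfinite.nonempty_gradedAlgebra_initialGrade hpn,
    SemiInfinite.nonempty_gradedAlgebra_hibiGrade _ _ _, SemiInfinite.initialEquivHibi hpn hl,
    SemiInfinite.mem_initialGrade_iff hpn hl, fun I hI k => ?_, fun Ψ hΨ => AlgEquiv.ext ?_⟩
  · rw [SemiInfinite.coe_initialEquivHibi_initialD hpn hl hI, hprod,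
      mul_div_cancel₀ _ (SemiInfinite.initSign_ne_zero k), Algebra.smul_def, map_pow, map_neg,
      map_one]
  · exact fun x => DFunLike.congr_fun (SemiInfinite.initialPluecker_algHom_ext hpn
      (Ψ := Ψ.toAlgHom) (Φ := (SemiInfinite.initialEquivHibi hpn hl).toAlgHom) hΨ) x
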